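/- Let $\mathbb F$ be a field of characteristic $p>2$, let $m,n\ge 0$, and let $\mathfrak g=gl(m,n)$ be the general linear Lie superalgebra over $\mathbb F$: the space of $(m+n)\times(m+n)$ matrices with matrix units $e_{ij}$, where $e_{ij}$ is even if $i,j\le m$ or $i,j>m$ and odd otherwise, with bracket $[x,y]=xy-(-1)^{\bar x\bar y}yx$ on homogeneous elements. Put $$\mathcal I_0=\{(i,j): 1\le i<j\le m\ \text{or}\ m+1\le i<j\le m+n\},\qquad \mathcal I_1=\{(i,j): 1\le i\le m<j\le m+n\}.$$ Let $\mathfrak g_{\bar 0}$ be the even part of $\mathfrak g$, let $\mathfrak g_1=\langle e_{ij}:(i,j)\in\mathcal I_1\rangle$ and $\mathfrak g^+=\mathfrak g_{\bar 0}+\mathfrak g_1$, and let $U(\cdot)$ denote the universal enveloping superalgebra. Let $H$ be the space of diagonal matrices, let $\epsilon_i\in H^*$ be given by $\epsilon_i(e_{jj})=\delta_{ij}$, and let $(\cdot,\cdot)$ be the symmetric bilinear form on $H^*$ with $(\epsilon_i,\epsilon_j)=\delta_{ij}$ if $i\le m$ and $-\delta_{ij}$ if $i>m$. Put $$\rho(m,n)=\tfrac12\sum_{(i,j)\in\mathcal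 I_0}(\epsilon_i-\epsilon_j)-\tfrac12\sum_{(i,j)\in\mathcal I_1}(\epsilon_i-\epsilon_j)\in H^*.$$ Let $\lambda\in H^*$, and let $M_0(\lambda)$ be a simple $U(\mathfrak g_{\bar 0})$-module generated by a maximal vector of weight $\lambda$, that is, by a vector $v\neq 0$ with $hv=\lambda(h)v$ for all $h\in H$ and $e_{ij}v=0$ for all $(i,j)\in\mathcal I_0$. Regard $M_0(\lambda)$ as a $U(\mathfrak g^+)$-module on which $\mathfrak g_1$ acts as zero, and let $$K(\lambda)=U(\mathfrak g)\otimes_{U(\mathfrak g^+)}M_0(\lambda)$$ be the Kac module, with the $\mathbb Z/2$-grading induced by that of $U(\mathfrak g)$ and $M_0(\lambda)$ placed in degree $\bar 0$. Then $K(\lambda)$ is simple if and only if $$\prod_{(i,j)\in\mathcal I_1}(\lambda+\rho(m,n),\,\epsilon_i-\epsilon_j)\neq 0.$$ This holds both when "simple" means that $K(\lambda)$ is nonzero and has no $\mathbb Z/2$-graded submodules other than $0$ and $K(\lambda)$, and when it means that $K(\lambda)$ is simple as an ungraded $U(\mathfrak g)$-module. -/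

import Mathlib

open scoped TensorProduct

namespace GLSuper

noncomputable section

/-! ### The Lie superalgebra `gl(m,n)` -/

/-- The index set `{1, …, m} ∪ {m+1, …, m+n}`; `Sum.inl` is the first block, `Sum.inr` the second. -/
abbrev Idx (m n : ℕ) : Type := Fin m ⊕ Fin n

/-- The underlying vector space of `gl(m,n)` over `F`: all `(m+n) × (m+n)` matrices. -/
abbrev Gl (m n : ℕ) (F : Type*) : Type _ := Matrix (Idx m n) (Idx m n) F

/-- The parity of an index: `0` for `i ≤ m`, and `1` for `i > m`. -/
def par {m n : ℕ} : Idx m n → ZMod 2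
  | Sum.inl _ => 0
  | Sum.inr _ => 1

variable {m n : ℕ} {F : Type*} [Field F]

/-- The homogeneous component `gl(m,n)_a`, for `a : ZMod 2`: matrices supported at the entries
`(i,j)` with `par i + par j = a`. -/
def homog (m n : ℕ) (F : Type*) [Field F] (a : ZMod 2) : Submodule F (Gl m n F) where
  carrier := {X | ∀ i j, par i + par j ≠ a → X i j = 0}
  add_mem' hX hY i j h := by simp [hX i j h, hY i j h]
  zero_mem' _ _ _ := rfl
  smul_mem' c X hX i j h := by simp [hX i j h]

/-- The projection `X ↦ X_a` of `gl(m,n)` onto `gl(m,n)_a`. -/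
def proj (a : ZMod 2) : Gl m n F →ₗ[F] Gl m n F where
  toFun X := Matrix.of fun i j => if par i + par j = a then X i j else 0
  map_add' X Y := by ext i j; by_cases h : par i + par j = a <;> simp [h]
  map_smul' c X := by ext i j; by_cases h : par i + par j = a <;> simp [h]

/-- The sign `(-1)^{ab}` for `a b : ZMod 2`. -/
def koszul (F : Type*) [Field F] (a b : ZMod 2) : F := (-1) ^ (a.val * b.val)

/-- The bracket of `gl(m,n)`: the bilinear extension of `[X,Y] = XY - (-1)^{ab} YX`, for `X` of
parity `a` and `Y` of parity `b`. -/
def sbracket (X Y : Gl m n F) : Gl m n F :=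
  ∑ a : ZMod 2, ∑ b : ZMod 2,
    (proj a X * proj b Y - koszul F a b • (proj b Y * proj a X))

theorem proj_of_mem {a : ZMod 2} {X : Gl m n F} (hX : X ∈ homog m n F a) : proj a X = X := by
  ext i j
  by_cases h : par i + par j = a
  · simp [proj, h]
  · simp [proj, h, hX i j h]

theorem proj_of_mem_ne {a b : ZMod 2} (hab : b ≠ a) {X : Gl m n F} (hX : X ∈ homog m n F a) :
    proj b X = 0 := by
  ext i j
  by_cases h : par i + par j = b
  · simp [proj, h, hX i j (by rw [h]; exact hab)]
  · simp [proj, h]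

theorem sbracket_of_mem {a b : ZMod 2} {X Y : Gl m n F} (hX : X ∈ homog m n F a)
    (hY : Y ∈ homog m n F b) : sbracket X Y = X * Y - koszul F a b • (Y * X) := by
  unfold sbracket
  rw [Finset.sum_eq_single a, Finset.sum_eq_single b, proj_of_mem hX, proj_of_mem hY]
  · intro c _ hc
    simp [proj_of_mem_ne hc hY]
  · simp
  · intro c _ hc
    simp [proj_of_mem_ne hc hX]
  · simp

/-- A Lie sub-superalgebra of `gl(m,n)`: a graded subspace which is closed under the bracket. -/
structure SubSuper (m n : ℕ) (F : Type*) [Field F] where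
  /-- The underlying subspace. -/
  carrier : Submodule F (Gl m n F)
  proj_mem : ∀ (a : ZMod 2), ∀ X ∈ carrier, proj a X ∈ carrier
  bracket_mem : ∀ X ∈ carrier, ∀ Y ∈ carrier, sbracket X Y ∈ carrier

/-- A graded subspace closed under the matrix product is a Lie sub-superalgebra. -/
def SubSuper.ofMul (S : Submodule F (Gl m n F))
    (hp : ∀ (a : ZMod 2), ∀ X ∈ S, proj a X ∈ S)
    (hm : ∀ X ∈ S, ∀ Y ∈ S, X * Y ∈ S) : SubSuper m n F where
  carrier := S
  proj_mem := hp
  bracket_mem X hX Y hY :=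
    S.sum_mem fun a _ => S.sum_mem fun b _ =>
      S.sub_mem (hm _ (hp a X hX) _ (hp b Y hY))
        (S.smul_mem _ (hm _ (hp b Y hY) _ (hp a X hX)))

/-- `𝔤 = gl(m,n)` itself. -/
def gFull (m n : ℕ) (F : Type*) [Field F] : SubSuper m n F :=
  SubSuper.ofMul ⊤ (fun _ _ _ => trivial) (fun _ _ _ _ => trivial)

/-- The even part `𝔤_0` of `gl(m,n)`: the block diagonal matrices. -/
def gEven (m n : ℕ) (F : Type*) [Field F] : SubSuper m n F :=
  SubSuper.ofMul (homog m n F 0)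
    (fun a X hX i j h => by simp [proj, hX i j h])
    (fun X hX Y hY i j h => by
      rw [Matrix.mul_apply]
      refine Finset.sum_eq_zero fun k _ => ?_
      by_cases hk : par i + par k = 0
      · rw [hY k j, mul_zero]
        intro hkj
        apply h
        generalize par i = x at *
        generalize par j = y at *
        generalize par k = z at *
        revert x y z
        decide
      · rw [hX i k hk, zero_mul])

/-- `𝔤⁺ = 𝔤_0 + 𝔤_1`, where `𝔤_1` is spanned by the `e_{ij}` with `i ≤ m < j`: the matrices whose
lower left block vanishes. -/
def gPlus (m n : ℕ) (F : Type*) [Field F] : SubSuper m n F :=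
  SubSuper.ofMul
    { carrier := {X | ∀ (i : Fin n) (j : Fin m), X (Sum.inr i) (Sum.inl j) = 0}
      add_mem' := fun hX hY i j => by simp [hX i j, hY i j]
      zero_mem' := fun _ _ => rfl
      smul_mem' := fun c X hX i j => by simp [hX i j] }
    (fun a X hX i j => by simp [proj, hX i j])
    (fun X hX Y hY i j => by
      rw [Matrix.mul_apply, Fintype.sum_sum_type]
      rw [Finset.sum_eq_zero fun k _ => by rw [hX i k, zero_mul],
        Finset.sum_eq_zero fun k _ => by rw [hY k j, mul_zero], add_zero])

/-! ### Universal enveloping superalgebras -/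

/-- The defining relations `x y = (-1)^{ab} y x + [x,y]` of the universal enveloping superalgebra,
for homogeneous `x`, `y` of parities `a`, `b`. -/
inductive URel (S : SubSuper m n F) :
    TensorAlgebra F S.carrier → TensorAlgebra F S.carrier → Prop
  | rel (a b : ZMod 2) (x y : S.carrier) (hx : (x : Gl m n F) ∈ homog m n F a)
      (hy : (y : Gl m n F) ∈ homog m n F b) :
      URel S (TensorAlgebra.ι F x * TensorAlgebra.ι F y)
        (koszul F a b • (TensorAlgebra.ι F y * TensorAlgebra.ι F x) +
          TensorAlgebra.ι F ⟨sbracket (x : Gl m n F) y, S.bracket_mem x x.2 y y.2⟩)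

/-- The universal enveloping superalgebra `U(S)` of a Lie sub-superalgebra `S` of `gl(m,n)`. -/
def U (S : SubSuper m n F) : Type _ := RingQuot (URel S)

instance (S : SubSuper m n F) : Ring (U S) := inferInstanceAs (Ring (RingQuot (URel S)))

instance (S : SubSuper m n F) : Algebra F (U S) := inferInstanceAs (Algebra F (RingQuot (URel S)))

/-- The quotient map from the tensor algebra of `S` onto `U(S)`. -/
def U.mk (S : SubSuper m n F) : TensorAlgebra F S.carrier →ₐ[F] U S :=
  RingQuot.mkAlgHom F (URel S)

/-- The canonical map `S → U(S)`. -/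
def U.ι (S : SubSuper m n F) : S.carrier →ₗ[F] U S :=
  (U.mk S).toLinearMap ∘ₗ TensorAlgebra.ι F

theorem U.ι_mul (S : SubSuper m n F) (a b : ZMod 2) (x y : S.carrier)
    (hx : (x : Gl m n F) ∈ homog m n F a) (hy : (y : Gl m n F) ∈ homog m n F b) :
    U.ι S x * U.ι S y = koszul F a b • (U.ι S y * U.ι S x) +
      U.ι S ⟨sbracket (x : Gl m n F) y, S.bracket_mem x x.2 y y.2⟩ := by
  have h : U.mk S _ = U.mk S _ := RingQuot.mkAlgHom_rel F (URel.rel (S := S) a b x y hx hy)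
  rw [map_mul, map_add, map_smul, map_mul] at h
  exact h

/-- The universal property of `U(S)`. -/
def U.lift (S : SubSuper m n F) {A : Type*} [Ring A] [Algebra F A] (f : S.carrier →ₗ[F] A)
    (hf : ∀ (a b : ZMod 2) (x y : S.carrier), (x : Gl m n F) ∈ homog m n F a →
      (y : Gl m n F) ∈ homog m n F b →
      f x * f y = koszul F a b • (f y * f x) +
        f ⟨sbracket (x : Gl m n F) y, S.bracket_mem x x.2 y y.2⟩) : U S →ₐ[F] A :=
  RingQuot.liftAlgHom F ⟨TensorAlgebra.lift F f, by
    rintro _ _ ⟨a, b, x, y, hx, hy⟩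
    simpa using hf a b x y hx hy⟩

theorem U.lift_ι (S : SubSuper m n F) {A : Type*} [Ring A] [Algebra F A] (f : S.carrier →ₗ[F] A)
    (hf) (x : S.carrier) : U.lift S f hf (U.ι S x) = f x := by
  change RingQuot.liftAlgHom F _ (RingQuot.mkAlgHom F (URel S) (TensorAlgebra.ι F x)) = f x
  rw [RingQuot.liftAlgHom_mkAlgHom_apply, TensorAlgebra.lift_ι_apply]

/-- The algebra map `U(𝔤⁺) → U(𝔤)` induced by the inclusion `𝔤⁺ ⊆ 𝔤`. -/
def inclU (m n : ℕ) (F : Type*) [Field F] : U (gPlus m n F) →ₐ[F] U (gFull m n F) :=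
  U.lift (gPlus m n F)
    (U.ι (gFull m n F) ∘ₗ Submodule.inclusion (le_top : (gPlus m n F).carrier ≤ ⊤))
    (fun a b x y hx hy => U.ι_mul (gFull m n F) a b ⟨x, trivial⟩ ⟨y, trivial⟩ hx hy)

theorem proj_zero_mem (X : Gl m n F) : proj 0 X ∈ (gEven m n F).carrier := by
  intro i j h
  simp [proj, h]

/-- The projection `𝔤⁺ = 𝔤_0 + 𝔤_1 → 𝔤_0` with kernel `𝔤_1`. -/
def gPlusProj (m n : ℕ) (F : Type*) [Field F] :
    (gPlus m n F).carrier →ₗ[F] (gEven m n F).carrier :=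
  LinearMap.codRestrict _ (proj 0 ∘ₗ (gPlus m n F).carrier.subtype) (fun x => proj_zero_mem x.1)

theorem gPlusProj_of_odd (x : (gPlus m n F).carrier) (hx : (x : Gl m n F) ∈ homog m n F 1) :
    gPlusProj m n F x = 0 :=
  Subtype.ext (proj_of_mem_ne (by decide) hx)

theorem gPlusProj_of_even (x : (gPlus m n F).carrier) (hx : (x : Gl m n F) ∈ homog m n F 0) :
    gPlusProj m n F x = ⟨x, hx⟩ :=
  Subtype.ext (proj_of_mem hx)

theorem mul_mem_homog {a b : ZMod 2} {X Y : Gl m n F} (hX : X ∈ homog m n F a)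
    (hY : Y ∈ homog m n F b) : X * Y ∈ homog m n F (a + b) := by
  intro i j h
  rw [Matrix.mul_apply]
  refine Finset.sum_eq_zero fun k _ => ?_
  by_cases hk : par i + par k = a
  · rw [hY k j, mul_zero]
    intro hkj
    apply h
    generalize par i = x at *
    generalize par j = y at *
    generalize par k = z at *
    subst hk
    subst hkj
    clear hX hY h
    revert x y z
    decide
  · rw [hX i k hk, zero_mul]

theorem sbracket_mem_homog {a b : ZMod 2} {X Y : Gl m n F} (hX : X ∈ homog m n F a)
    (hY : Y ∈ homog m n F b) : sbracket X Y ∈ homog m n F (a + b) := by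
  rw [sbracket_of_mem hX hY]
  exact Submodule.sub_mem _ (mul_mem_homog hX hY)
    (Submodule.smul_mem _ _ (add_comm b a ▸ mul_mem_homog hY hX))

/-- The product of two odd elements of `𝔤⁺` (that is, of two elements of `𝔤_1`) is zero. -/
theorem odd_mul_odd {X Y : Gl m n F} (hX : X ∈ (gPlus m n F).carrier)
    (hY : Y ∈ (gPlus m n F).carrier) (hX' : X ∈ homog m n F 1) (hY' : Y ∈ homog m n F 1) :
    X * Y = 0 := by
  ext i j
  rw [Matrix.mul_apply]
  refine Finset.sum_eq_zero fun k _ => ?_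
  rcases i with i | i <;> rcases k with k | k
  · rw [hX' _ _ (by simp [par]), zero_mul]
  · rcases j with j | j
    · rw [hY k j, mul_zero]
    · rw [hY' _ _ (by simp only [par]; decide), mul_zero]
  · rw [hX i k, zero_mul]
  · rw [hX' _ _ (by simp only [par]; decide), zero_mul]

/-- The algebra map `U(𝔤⁺) → U(𝔤_0)` induced by the projection `𝔤⁺ → 𝔤_0`. Restriction along it is
the extension of a `U(𝔤_0)`-module to `U(𝔤⁺)` on which `𝔤_1` acts as zero. -/
def projU (m n : ℕ) (F : Type*) [Field F] : U (gPlus m n F) →ₐ[F] U (gEven m n F) :=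
  U.lift (gPlus m n F) (U.ι (gEven m n F) ∘ₗ gPlusProj m n F) (by
    intro a b x y hx hy
    have hxy := sbracket_mem_homog hx hy
    simp only [LinearMap.comp_apply]
    have h01 : ∀ c : ZMod 2, c = 0 ∨ c = 1 := by decide
    rcases h01 a with rfl | rfl <;> rcases h01 b with rfl | rfl
    · rw [gPlusProj_of_even x hx, gPlusProj_of_even y hy,
        gPlusProj_of_even ⟨sbracket (x : Gl m n F) y, _⟩ hxy]
      exact U.ι_mul (gEven m n F) 0 0 ⟨x, hx⟩ ⟨y, hy⟩ hx hy
    · rw [gPlusProj_of_odd y hy, gPlusProj_of_odd ⟨sbracket (x : Gl m n F) y, _⟩ hxy]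
      simp
    · rw [gPlusProj_of_odd x hx, gPlusProj_of_odd ⟨sbracket (x : Gl m n F) y, _⟩ hxy]
      simp
    · rw [gPlusProj_of_odd x hx]
      have hz : (⟨sbracket (x : Gl m n F) y, (gPlus m n F).bracket_mem x x.2 y y.2⟩ :
          (gPlus m n F).carrier) = 0 := by
        apply Subtype.ext
        change sbracket (x : Gl m n F) y = 0
        rw [sbracket_of_mem hx hy, odd_mul_odd x.2 y.2 hx hy, odd_mul_odd y.2 x.2 hy hx]
        simp
      rw [hz]
      simp)

/-! ### Kac modules -/

section Kac

variable (m n : ℕ) (F : Type*) [Field F] (M : Type*) [AddCommGroup M] [Module F M] [Module (U (gEven m n F)) M]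

/-- The relations `u a ⊗ x = u ⊗ a x` (`u ∈ U(𝔤)`, `a ∈ U(𝔤⁺)`, `x ∈ M`) of the tensor product
over `U(𝔤⁺)`, as a `U(𝔤)`-submodule of `U(𝔤) ⊗_F M`; here `a` acts on `M` through `projU`. -/
def kacRel : Submodule (U (gFull m n F)) (U (gFull m n F) ⊗[F] M) :=
  Submodule.span (U (gFull m n F))
    {t | ∃ (u : U (gFull m n F)) (a : U (gPlus m n F)) (x : M),
      t = (u * inclU m n F a) ⊗ₜ[F] x - u ⊗ₜ[F] (projU m n F a • x)}

/-- The Kac module `U(𝔤) ⊗_{U(𝔤⁺)} M`, where `M` is a `U(𝔤_0)`-module extended to `U(𝔤⁺)` by letting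
`𝔤_1` act as zero. -/
abbrev Kac : Type _ := (U (gFull m n F) ⊗[F] M) ⧸ kacRel m n F M

/-- `u` is a product of homogeneous elements of `S` whose parities add up to `a`. -/
inductive IsMonomial {m n : ℕ} {F : Type*} [Field F] (S : SubSuper m n F) : ZMod 2 → U S → Prop
  | one : IsMonomial S 0 1
  | ι_mul (a b : ZMod 2) (x : S.carrier) (hx : (x : Gl m n F) ∈ homog m n F a) (u : U S)
      (hu : IsMonomial S b u) : IsMonomial S (a + b) (U.ι S x * u)

/-- The homogeneous component `U(S)_a`. -/
def uHomog {m n : ℕ} {F : Type*} [Field F] (S : SubSuper m n F) (a : ZMod 2) : Submodule F (U S) :=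
  Submodule.span F {u | IsMonomial S a u}

/-- The homogeneous component `U(𝔤)_a ⊗ M` of the Kac module; `M` is placed in degree `0`. -/
def kacHomog (a : ZMod 2) : AddSubgroup (Kac m n F M) :=
  AddSubgroup.closure
    {t | ∃ u ∈ uHomog (gFull m n F) a, ∃ x : M, t = (kacRel m n F M).mkQ (u ⊗ₜ[F] x)}

/-- A submodule `N` of the Kac module `K` is graded if `N = (N ∩ K_0) + (N ∩ K_1)`. -/
def IsGradedSub (N : Submodule (U (gFull m n F)) (Kac m n F M)) : Prop :=
  ∀ t ∈ N, ∃ t₀ ∈ N, ∃ t₁ ∈ N, t₀ ∈ kacHomog m n F M 0 ∧ t₁ ∈ kacHomog m n F M 1 ∧ t = t₀ + t₁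

/-- Simplicity of the Kac module as a module over a superalgebra: it is nonzero, and its only graded
submodules are zero and the whole module. -/
def KacIsGradedSimple : Prop :=
  Nontrivial (Kac m n F M) ∧
    ∀ N : Submodule (U (gFull m n F)) (Kac m n F M),
      IsGradedSub m n F M N → N = ⊥ ∨ N = ⊤

end Kac

/-! ### Weights -/

/-- `H^* = Λ ⊗_ℤ F`, in coordinates: `lam` stands for `∑ i, lam i • ε_i`. -/
abbrev Weight (m n : ℕ) (F : Type*) : Type _ := Idx m n → F

/-- The weight `ε_i`. -/
def ε (i : Idx m n) : Weight m n F := Pi.single i 1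

/-- The symmetric bilinear form on `H^*` with `(ε_i, ε_j) = δ_ij` for `i ≤ m` and `-δ_ij` for
`i > m`. -/
def form (lam μ : Weight m n F) : F :=
  (∑ i : Fin m, lam (Sum.inl i) * μ (Sum.inl i)) - ∑ i : Fin n, lam (Sum.inr i) * μ (Sum.inr i)

/-- `(i,j) ∈ I_0`: either `i < j ≤ m` or `m < i < j`. -/
def InI0 : Idx m n × Idx m n → Prop
  | (Sum.inl i, Sum.inl j) => i < j
  | (Sum.inr i, Sum.inr j) => i < j
  | _ => False

/-- `(i,j) ∈ I_1`: `i ≤ m < j`. -/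
def InI1 : Idx m n × Idx m n → Prop
  | (Sum.inl _, Sum.inr _) => True
  | _ => False

open scoped Classical in
/-- The set `I_0`. -/
def I0 (m n : ℕ) : Finset (Idx m n × Idx m n) := {q | InI0 q}

open scoped Classical in
/-- The set `I_1`. -/
def I1 (m n : ℕ) : Finset (Idx m n × Idx m n) := {q | InI1 q}

/-- `ρ_0`, half the sum of the positive even roots. -/
def ρ0 (m n : ℕ) (F : Type*) [Field F] : Weight m n F :=
  (2 : F)⁻¹ • ∑ q ∈ I0 m n, (ε q.1 - ε q.2)

/-- `ρ_1`, half the sum of the positive odd roots. -/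
def ρ1 (m n : ℕ) (F : Type*) [Field F] : Weight m n F :=
  (2 : F)⁻¹ • ∑ q ∈ I1 m n, (ε q.1 - ε q.2)

/-- `ρ(m,n) = ρ_0 - ρ_1`. -/
def ρ (m n : ℕ) (F : Type*) [Field F] : Weight m n F := ρ0 m n F - ρ1 m n F

theorem single_mem_gEven {i j : Idx m n} (h : par i = par j) (c : F) :
    Matrix.single i j c ∈ (gEven m n F).carrier := by
  intro k l hkl
  rw [Matrix.single_apply, if_neg]
  rintro ⟨rfl, rfl⟩
  apply hkl
  rw [h]
  generalize par j = x
  revert x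
  decide

/-- The matrix unit `e_{ij}` as an element of `𝔤_0`, for `i`, `j` in the same block. -/
def eUnit {i j : Idx m n} (h : par i = par j) : (gEven m n F).carrier :=
  ⟨Matrix.single i j 1, single_mem_gEven h 1⟩

theorem InI0.par_eq : ∀ {i j : Idx m n}, InI0 (i, j) → par i = par j
  | Sum.inl _, Sum.inl _, _ => rfl
  | Sum.inr _, Sum.inr _, _ => rfl

/-- `v` is a maximal vector of weight `lam` in the `U(𝔤_0)`-module `M`: it is nonzero,
`h v = lam(h) v` for all `h ∈ H` (equivalently, for the basis `h = e_{ii}` of `H`), and `e_{ij} v = 0`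
for all `(i,j) ∈ I_0`. -/
structure IsMaximalVector {M : Type*} [AddCommGroup M] [Module F M] [Module (U (gEven m n F)) M]
    (lam : Weight m n F) (v : M) : Prop where
  ne_zero : v ≠ 0
  weight : ∀ i : Idx m n, U.ι (gEven m n F) (eUnit (rfl : par i = par i)) • v = lam i • v
  raising : ∀ (i j : Idx m n) (h : InI0 (i, j)),
    U.ι (gEven m n F) (eUnit h.par_eq) • v = 0

end

end GLSuper

open GLSuper

/-! Write 𝔤 = 𝔤_{-1} + 𝔤_0 + 𝔤_1, and let T₋ and T₊ be the products of all matrix units of 𝔤_{-1}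
and of 𝔤_1, in suitable orders. The units of 𝔤_{-1} anticommute and square to zero, so K(λ) is
spanned by products of distinct ones applied to 1 ⊗ M. T₋ and T₊ are top exterior products, hence
commute with 𝔤_0 up to adding a scalar multiple of themselves (`Anticommuting.exists_mul_prod_eq`).

Multiplying a nonzero vector by the units missing from a shortest term gives T₋ ⊗ y with y ≠ 0, so
every nonzero submodule contains such a vector (`exists_lower_prod_mem`), and then T₋ ⊗ v because M
is simple. Everything is therefore decided by T₊T₋ on 1 ⊗ v. With the odd roots ordered compatibly
with the even raising operators, each e_{ij} in 𝔤_1 strips off its partner e_{ji} and leaves the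
scalar (λ + ρ, ε_i - ε_j); the ρ-shift counts the factors still to the right
(`upper_lower_lower_prod`). Thus T₊T₋(1 ⊗ v) is the product in the theorem times 1 ⊗ v
(`upper_prod_lower_prod`).

If the product is nonzero, 1 ⊗ v is recovered and generates K(λ). If it is zero, T₊T₋ kills 1 ⊗ M,
and the graded submodule generated by T₋ ⊗ M has zero component in 1 ⊗ M
(`kacProj_smul_lower_prod`); it is nonzero and proper, so even graded simplicity fails.

The argument needs K(λ) to be large enough: 1 ⊗ M must embed, with a projection back onto it, and T₋
⊗ v must be nonzero. This comes from an explicit action of 𝔤 on Λ(𝔤_{-1}) ⊗ M, in which 𝔤_1 acts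
through contractions (`Oscillator.op_relation`), and the resulting map `kacToModel`. -/

namespace GLSuper

/-! ### Products of anticommuting elements of square zero -/

section Anticommuting

variable {F U ι : Type*} [Field F] [Ring U] [Algebra F U]

/-- A family of pairwise anticommuting elements of square zero. -/
structure Anticommuting (x : ι → U) : Prop where
  sq : ∀ a, x a * x a = 0
  anti : ∀ a b, x a * x b = -(x b * x a)

/-- The sign of the permutation is left undetermined: later uses concern only vanishing and
membership in subspaces, which a sign does not affect. -/
theorem Anticommuting.prod_perm {x : ι → U} (hx : Anticommuting x) {l l' : List ι}
    (h : l.Perm l') :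
    (l.map x).prod = (l'.map x).prod ∨ (l.map x).prod = -(l'.map x).prod := by
  induction h with
  | nil => simp
  | cons a _ ih => rcases ih with ih | ih <;> simp [ih]
  | swap a b l =>
    right
    simp only [List.map_cons, List.prod_cons, ← mul_assoc]
    rw [hx.anti b a, neg_mul]
  | trans _ _ ih₁ ih₂ =>
    rcases ih₁ with ih₁ | ih₁ <;> rcases ih₂ with ih₂ | ih₂ <;> simp [ih₁, ih₂]

theorem Anticommuting.prod_eq_zero {x : ι → U} (hx : Anticommuting x) {l : List ι}
    (h : ¬ l.Nodup) : (l.map x).prod = 0 := by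
  obtain ⟨a, ha⟩ := List.exists_duplicate_iff_not_nodup.2 h
  obtain ⟨l', hl'⟩ := (List.duplicate_iff_sublist.1 ha).exists_perm_append
  have h0 : (([a, a] ++ l').map x).prod = 0 := by
    simp [← mul_assoc, hx.sq]
  rcases hx.prod_perm hl' with h | h <;> simp only [h, h0, neg_zero]

theorem Anticommuting.mul_prod_eq_zero {x : ι → U} (hx : Anticommuting x) {l : List ι} {a : ι}
    (h : a ∈ l) : x a * (l.map x).prod = 0 := by
  rw [← List.prod_cons, ← List.map_cons]
  exact hx.prod_eq_zero (fun hn => (List.nodup_cons.1 hn).1 h)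

theorem Anticommuting.prod_of_length {x : ι → U} (hx : Anticommuting x) {L l : List ι}
    (hL : ∀ a, a ∈ L) (hl : L.length ≤ l.length) :
    (l.map x).prod = (L.map x).prod ∨ (l.map x).prod = -(L.map x).prod ∨
      (l.map x).prod = 0 := by
  by_cases hd : l.Nodup
  · have := (List.subperm_of_subset hd (fun a _ => hL a)).perm_of_length_le hl
    rcases hx.prod_perm this with h | h
    · exact Or.inl h
    · exact Or.inr (Or.inl h)
  · exact Or.inr (Or.inr (hx.prod_eq_zero hd))

/-- Leibniz rule: commuting D past the product replaces one factor at a time by a combination of the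
x's, so the number of factors does not change. -/
theorem commutator_prod_mem_span {x : ι → U} {D : U}
    (hD : ∀ a, D * x a - x a * D ∈ Submodule.span F (Set.range x)) (l : List ι) :
    D * (l.map x).prod - (l.map x).prod * D ∈
      Submodule.span F {u | ∃ l' : List ι, l'.length = l.length ∧ u = (l'.map x).prod} := by
  induction l with
  | nil => simp
  | cons a l ih =>
    have hsplit : D * ((a :: l).map x).prod - ((a :: l).map x).prod * D =
        (D * x a - x a * D) * (l.map x).prod +
          x a * (D * (l.map x).prod - (l.map x).prod * D) := by
      simp only [List.map_cons, List.prod_cons]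
      noncomm_ring
    rw [hsplit]
    refine Submodule.add_mem _ ?_ ?_
    · refine Submodule.span_induction (p := fun y _ => y * (l.map x).prod ∈ _) ?_ ?_ ?_ ?_ (hD a)
      · rintro _ ⟨b, rfl⟩
        exact Submodule.subset_span ⟨b :: l, by simp, by simp⟩
      · simp
      · intro y z _ _ hy hz
        rw [add_mul]
        exact Submodule.add_mem _ hy hz
      · intro c y _ hy
        rw [smul_mul_assoc]
        exact Submodule.smul_mem _ c hy
    · refine Submodule.span_induction (p := fun y _ => x a * y ∈ _) ?_ ?_ ?_ ?_ ih
      · rintro _ ⟨l', hl', rfl⟩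
        exact Submodule.subset_span ⟨a :: l', by simp [hl'], by simp⟩
      · simp
      · intro y z _ _ hy hz
        rw [mul_add]
        exact Submodule.add_mem _ hy hz
      · intro c y _ hy
        rw [mul_smul_comm]
        exact Submodule.smul_mem _ c hy

/-- An element normalizing the span of an anticommuting family rescales the top product. -/
theorem Anticommuting.exists_mul_prod_eq {x : ι → U} (hx : Anticommuting x) {D : U}
    (hD : ∀ a, D * x a - x a * D ∈ Submodule.span F (Set.range x)) {L : List ι}
    (hL : ∀ a, a ∈ L) :
    ∃ k : F, D * (L.map x).prod = (L.map x).prod * D + k • (L.map x).prod := by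
  have h := commutator_prod_mem_span hD L
  have hle : Submodule.span F {u | ∃ l' : List ι, l'.length = L.length ∧ u = (l'.map x).prod} ≤
      Submodule.span F {(L.map x).prod} := by
    refine Submodule.span_le.2 ?_
    rintro _ ⟨l', hl', rfl⟩
    rcases hx.prod_of_length hL hl'.ge with h | h | h <;> rw [h]
    · exact Submodule.mem_span_singleton_self _
    · exact Submodule.neg_mem _ (Submodule.mem_span_singleton_self _)
    · exact Submodule.zero_mem _
  obtain ⟨k, hk⟩ := Submodule.mem_span_singleton.1 (hle h)
  exact ⟨k, by rw [hk]; abel⟩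

end Anticommuting

end GLSuper

namespace GLSuper

noncomputable section

/-! ### The relations of `gl(m,n)` from wedge and contraction operators -/

section Model

variable {m n : ℕ} {F : Type*} [Field F]

/-- The action of the even part on `𝔤_{-1}`, in block coordinates. -/
def adLower (m n : ℕ) (F : Type*) [Field F] :
    (Matrix (Fin m) (Fin m) F × Matrix (Fin n) (Fin n) F) →ₗ[F]
      Matrix (Fin n) (Fin m) F →ₗ[F] Matrix (Fin n) (Fin m) F :=
  LinearMap.mk₂ F (fun h C => h.2 * C - C * h.1)
    (fun h h' C => by simp only [Prod.fst_add, Prod.snd_add, Matrix.add_mul, Matrix.mul_add]; abel)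
    (fun c h C => by simp [smul_sub])
    (fun h C C' => by simp only [Matrix.add_mul, Matrix.mul_add]; abel)
    (fun c h C => by simp [smul_sub])

/-- The bracket of `𝔤_1` and `𝔤_{-1}`, in block coordinates. -/
def brOdd (m n : ℕ) (F : Type*) [Field F] :
    Matrix (Fin m) (Fin n) F →ₗ[F] Matrix (Fin n) (Fin m) F →ₗ[F]
      (Matrix (Fin m) (Fin m) F × Matrix (Fin n) (Fin n) F) :=
  LinearMap.mk₂ F (fun B C => (B * C, C * B))
    (fun B B' C => by simp [Matrix.add_mul, Matrix.mul_add])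
    (fun c B C => by simp)
    (fun B C C' => by simp [Matrix.add_mul, Matrix.mul_add])
    (fun c B C => by simp)

theorem adLower_apply (h : Matrix (Fin m) (Fin m) F × Matrix (Fin n) (Fin n) F)
    (C : Matrix (Fin n) (Fin m) F) : adLower m n F h C = h.2 * C - C * h.1 := rfl

theorem brOdd_apply (B : Matrix (Fin m) (Fin n) F) (C : Matrix (Fin n) (Fin m) F) :
    brOdd m n F B C = (B * C, C * B) := rfl

/-- The Jacobi identity for B, C, C', where [C, C'] = 0. This antisymmetry makes the coefficient 1/2
in `Oscillator.upperOp` correct. -/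
theorem adLower_brOdd_swap (B : Matrix (Fin m) (Fin n) F) (C C' : Matrix (Fin n) (Fin m) F) :
    adLower m n F (brOdd m n F B C) C' = -adLower m n F (brOdd m n F B C') C := by
  simp [adLower_apply, brOdd_apply, Matrix.mul_assoc]

theorem adLower_commutator (h h' : Matrix (Fin m) (Fin m) F × Matrix (Fin n) (Fin n) F)
    (C : Matrix (Fin n) (Fin m) F) :
    adLower m n F (h * h' - h' * h) C =
      adLower m n F h (adLower m n F h' C) - adLower m n F h' (adLower m n F h C) := by
  simp only [adLower_apply, Prod.fst_sub, Prod.snd_sub, Prod.fst_mul, Prod.snd_mul,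
    Matrix.sub_mul, Matrix.mul_sub, Matrix.mul_assoc]
  abel

theorem brOdd_derivation (h : Matrix (Fin m) (Fin m) F × Matrix (Fin n) (Fin n) F)
    (B : Matrix (Fin m) (Fin n) F) (C : Matrix (Fin n) (Fin m) F) :
    brOdd m n F (h.1 * B - B * h.2) C =
      h * brOdd m n F B C - brOdd m n F B C * h - brOdd m n F B (adLower m n F h C) := by
  ext1 <;> simp only [adLower_apply, brOdd_apply, Prod.fst_sub, Prod.snd_sub, Prod.fst_mul,
    Prod.snd_mul, Matrix.sub_mul, Matrix.mul_sub, Matrix.mul_assoc] <;> abel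

theorem sum_coord_smul {A : Type*} [AddCommGroup A] [Module F A]
    (f : Matrix (Fin n) (Fin m) F →ₗ[F] A) (C : Matrix (Fin n) (Fin m) F) :
    ∑ a : Fin n × Fin m, C a.1 a.2 • f (Matrix.single a.1 a.2 1) = f C := by
  conv_rhs => rw [Matrix.matrix_eq_sum_single C]
  rw [Fintype.sum_prod_type, map_sum]
  refine Finset.sum_congr rfl fun j _ => ?_
  rw [map_sum]
  refine Finset.sum_congr rfl fun i _ => ?_
  rw [← map_smul, Matrix.smul_single, smul_eq_mul, mul_one]

theorem fromBlocks_sub_fromBlocks (A A' : Matrix (Fin m) (Fin m) F) (B B' : Matrix (Fin m) (Fin n) F)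
    (C C' : Matrix (Fin n) (Fin m) F) (D D' : Matrix (Fin n) (Fin n) F) :
    Matrix.fromBlocks A B C D - Matrix.fromBlocks A' B' C' D' =
      Matrix.fromBlocks (A - A') (B - B') (C - C') (D - D') := by
  ext (i | i) (j | j) <;> rfl

theorem eq_fromBlocks_of_even {X : Gl m n F} (hX : X ∈ homog m n F 0) :
    ∃ A D, X = Matrix.fromBlocks A 0 0 D := by
  refine ⟨X.toBlocks₁₁, X.toBlocks₂₂, ?_⟩
  conv_lhs => rw [← Matrix.fromBlocks_toBlocks X]
  congr 1
  · ext i j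
    exact hX _ _ (by simp [par])
  · ext i j
    exact hX _ _ (by simp [par])

theorem eq_fromBlocks_of_odd {X : Gl m n F} (hX : X ∈ homog m n F 1) :
    ∃ B C, X = Matrix.fromBlocks 0 B C 0 := by
  refine ⟨X.toBlocks₁₂, X.toBlocks₂₁, ?_⟩
  conv_lhs => rw [← Matrix.fromBlocks_toBlocks X]
  congr 1
  · ext i j
    exact hX _ _ (by simp [par])
  · ext i j
    exact hX _ _ (by simp only [par]; decide)


/-- Operators realizing the exterior multiplications and contractions on `Λ(𝔤_{-1})` and a commuting
action of the even part; `vac` is the left ideal of operators killing the vacuum vectors. -/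
structure Oscillator (m n : ℕ) (F : Type*) [Field F] (R : Type*) [Ring R] [Algebra F R] where
  /-- Exterior multiplication. -/
  wedge : Matrix (Fin n) (Fin m) F →ₗ[F] R
  /-- Contraction with the coordinate functions. -/
  contr : Fin n × Fin m → R
  /-- The action of the even part on the coefficients. -/
  evenRight : (Matrix (Fin m) (Fin m) F × Matrix (Fin n) (Fin n) F) →ₗ[F] R
  /-- The operators that kill the vacuum vectors. -/
  vac : Submodule R R
  wedge_mul_wedge : ∀ C C', wedge C * wedge C' = -(wedge C' * wedge C)
  contr_mul_wedge : ∀ a C, contr a * wedge C = C a.1 a.2 • 1 - wedge C * contr a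
  evenRight_mul_wedge : ∀ h C, evenRight h * wedge C = wedge C * evenRight h
  contr_mul_evenRight : ∀ a h, contr a * evenRight h = evenRight h * contr a
  evenRight_commutator : ∀ h h', evenRight h * evenRight h' - evenRight h' * evenRight h =
    evenRight (h * h' - h' * h)
  contr_mem : ∀ a, contr a ∈ vac
  eq_zero : ∀ (T : R) (c : F), (∀ C, T * wedge C = c • (wedge C * T)) → T ∈ vac → T = 0

namespace Oscillator

variable {R : Type*} [Ring R] [Algebra F R] (O : Oscillator m n F R)

/-- The derivation action of the even part on the exterior factor. -/
def evenLeft : (Matrix (Fin m) (Fin m) F × Matrix (Fin n) (Fin n) F) →ₗ[F] R :=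
  ∑ a : Fin n × Fin m, LinearMap.mulRight F (O.contr a) ∘ₗ O.wedge ∘ₗ
    (adLower m n F).flip (Matrix.single a.1 a.2 1)

theorem evenLeft_apply (h : Matrix (Fin m) (Fin m) F × Matrix (Fin n) (Fin n) F) :
    O.evenLeft h = ∑ a : Fin n × Fin m,
      O.wedge (adLower m n F h (Matrix.single a.1 a.2 1)) * O.contr a := by
  simp [evenLeft, LinearMap.sum_apply]

theorem evenLeft_mul_wedge (h : Matrix (Fin m) (Fin m) F × Matrix (Fin n) (Fin n) F)
    (C : Matrix (Fin n) (Fin m) F) :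
    O.evenLeft h * O.wedge C = O.wedge C * O.evenLeft h + O.wedge (adLower m n F h C) := by
  have hc := sum_coord_smul (O.wedge ∘ₗ adLower m n F h) C
  rw [LinearMap.comp_apply] at hc
  rw [evenLeft_apply, Finset.sum_mul, Finset.mul_sum, ← hc, ← Finset.sum_add_distrib]
  refine Finset.sum_congr rfl fun a _ => ?_
  rw [mul_assoc, O.contr_mul_wedge, mul_sub, ← mul_assoc, O.wedge_mul_wedge]
  simp only [mul_smul_comm, mul_one, LinearMap.comp_apply, neg_mul, mul_assoc]
  abel

theorem evenLeft_mul_evenRight (h h' : Matrix (Fin m) (Fin m) F × Matrix (Fin n) (Fin n) F) :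
    O.evenLeft h * O.evenRight h' = O.evenRight h' * O.evenLeft h := by
  rw [evenLeft_apply, Finset.sum_mul, Finset.mul_sum]
  refine Finset.sum_congr rfl fun a _ => ?_
  rw [mul_assoc, O.contr_mul_evenRight, ← mul_assoc, ← mul_assoc, O.evenRight_mul_wedge]

theorem evenLeft_mem (h : Matrix (Fin m) (Fin m) F × Matrix (Fin n) (Fin n) F) :
    O.evenLeft h ∈ O.vac := by
  rw [evenLeft_apply]
  exact Submodule.sum_mem _ fun a _ => Submodule.smul_mem _ _ (O.contr_mem a)

/-- The action of the even part. -/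
def evenOp : (Matrix (Fin m) (Fin m) F × Matrix (Fin n) (Fin n) F) →ₗ[F] R :=
  O.evenRight + O.evenLeft

theorem evenOp_mul_wedge (h : Matrix (Fin m) (Fin m) F × Matrix (Fin n) (Fin n) F)
    (C : Matrix (Fin n) (Fin m) F) :
    O.evenOp h * O.wedge C = O.wedge C * O.evenOp h + O.wedge (adLower m n F h C) := by
  simp only [evenOp, LinearMap.add_apply, add_mul, mul_add, O.evenRight_mul_wedge,
    evenLeft_mul_wedge]
  abel

/-- The action of `𝔤_1`. -/
def upperOp : Matrix (Fin m) (Fin n) F →ₗ[F] R :=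
  ∑ a : Fin n × Fin m, LinearMap.mulRight F (O.contr a) ∘ₗ
    -- Expanding `evenLeft` gives a sum over ordered pairs (a, b) of contractions whose terms are
    -- symmetric in a and b, while moving B through a product meets each pair once; hence the 1/2.
    (O.evenRight + (2 : F)⁻¹ • O.evenLeft) ∘ₗ (brOdd m n F).flip (Matrix.single a.1 a.2 1)

theorem upperOp_apply (B : Matrix (Fin m) (Fin n) F) :
    O.upperOp B = ∑ a : Fin n × Fin m,
      (O.evenRight + (2 : F)⁻¹ • O.evenLeft) (brOdd m n F B (Matrix.single a.1 a.2 1)) *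
        O.contr a := by
  simp [upperOp, LinearMap.sum_apply]

theorem upperOp_mem (B : Matrix (Fin m) (Fin n) F) : O.upperOp B ∈ O.vac := by
  rw [upperOp_apply]
  exact Submodule.sum_mem _ fun a _ => Submodule.smul_mem _ _ (O.contr_mem a)

/-- `vac` is only a left ideal, so multiplication on the right needs an argument: contractions
commute past `evenRight`, and `evenLeft` already ends in a contraction. -/
theorem upperOp_mul_evenOp_mem (B : Matrix (Fin m) (Fin n) F)
    (h : Matrix (Fin m) (Fin m) F × Matrix (Fin n) (Fin n) F) :
    O.upperOp B * O.evenOp h ∈ O.vac := by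
  rw [evenOp, LinearMap.add_apply, mul_add]
  refine Submodule.add_mem _ ?_ (Submodule.smul_mem _ _ (O.evenLeft_mem h))
  rw [upperOp_apply, Finset.sum_mul]
  refine Submodule.sum_mem _ fun a _ => ?_
  rw [mul_assoc, O.contr_mul_evenRight]
  exact Submodule.smul_mem _ _ (Submodule.smul_mem _ _ (O.contr_mem a))

/-- Contracting against C yields [B, C] with only half of its `evenLeft` part. The other half
appears when C moves past the `evenLeft` terms of `upperOp`, after `adLower_brOdd_swap`. -/
theorem upperOp_mul_wedge (h2 : (2 : F) ≠ 0) (B : Matrix (Fin m) (Fin n) F)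
    (C : Matrix (Fin n) (Fin m) F) :
    O.upperOp B * O.wedge C = -(O.wedge C * O.upperOp B) + O.evenOp (brOdd m n F B C) := by
  have key : ∀ h : Matrix (Fin m) (Fin m) F × Matrix (Fin n) (Fin n) F,
      (O.evenRight + (2 : F)⁻¹ • O.evenLeft) h * O.wedge C =
        O.wedge C * (O.evenRight + (2 : F)⁻¹ • O.evenLeft) h +
          (2 : F)⁻¹ • O.wedge (adLower m n F h C) := by
    intro h
    simp only [LinearMap.add_apply, LinearMap.smul_apply, add_mul, mul_add, O.evenRight_mul_wedge,
      smul_mul_assoc, evenLeft_mul_wedge, mul_smul_comm, smul_add]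
    abel
  have hhalf : O.evenOp (brOdd m n F B C) =
      (O.evenRight + (2 : F)⁻¹ • O.evenLeft) (brOdd m n F B C) +
        (2 : F)⁻¹ • O.evenLeft (brOdd m n F B C) := by
    simp only [evenOp, LinearMap.add_apply, LinearMap.smul_apply, add_assoc, ← add_smul]
    rw [← two_mul, mul_inv_cancel₀ h2, one_smul]
  rw [hhalf, upperOp_apply, Finset.sum_mul, Finset.mul_sum, evenLeft_apply, Finset.smul_sum]
  have hc := sum_coord_smul ((O.evenRight + (2 : F)⁻¹ • O.evenLeft) ∘ₗ brOdd m n F B) C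
  rw [LinearMap.comp_apply] at hc
  rw [← hc, ← Finset.sum_neg_distrib, ← Finset.sum_add_distrib, ← Finset.sum_add_distrib]
  refine Finset.sum_congr rfl fun a _ => ?_
  rw [mul_assoc, O.contr_mul_wedge, mul_sub, ← mul_assoc, key, adLower_brOdd_swap]
  simp only [mul_smul_comm, mul_one, LinearMap.comp_apply, map_neg, smul_neg, add_mul, neg_mul,
    smul_mul_assoc, mul_assoc]
  abel

/-- An operator that commutes or anticommutes with all wedges and kills the vacuum is zero. So it
suffices that both sides have the same commutators with wedges, because `adLower` is a Lie action,
and that they agree on the vacuum, where only `evenRight` survives. The next two relations are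
proved on the same principle. -/
theorem evenOp_commutator (h h' : Matrix (Fin m) (Fin m) F × Matrix (Fin n) (Fin n) F) :
    O.evenOp h * O.evenOp h' - O.evenOp h' * O.evenOp h = O.evenOp (h * h' - h' * h) := by
  rw [← sub_eq_zero]
  refine O.eq_zero _ 1 (fun C => ?_) ?_
  · have e1 := O.evenOp_mul_wedge (h * h' - h' * h) C
    rw [adLower_commutator, map_sub O.wedge] at e1
    rw [sub_mul, e1]
    simp only [sub_mul, mul_sub, mul_assoc, evenOp_mul_wedge, one_smul, mul_add]
    simp only [← mul_assoc, evenOp_mul_wedge, add_mul]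
    abel
  · have e : O.evenOp h * O.evenOp h' - O.evenOp h' * O.evenOp h - O.evenOp (h * h' - h' * h) =
        (O.evenRight h + O.evenLeft h) * O.evenLeft h' + O.evenRight h' * O.evenLeft h -
          ((O.evenRight h' + O.evenLeft h') * O.evenLeft h + O.evenRight h * O.evenLeft h') -
            O.evenLeft (h * h' - h' * h) := by
      simp only [evenOp, LinearMap.add_apply, ← O.evenRight_commutator, add_mul, mul_add,
        evenLeft_mul_evenRight]
      abel
    rw [e]
    exact Submodule.sub_mem _ (Submodule.sub_mem _
      (Submodule.add_mem _ (Submodule.smul_mem _ _ (O.evenLeft_mem _))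
        (Submodule.smul_mem _ _ (O.evenLeft_mem _)))
      (Submodule.add_mem _ (Submodule.smul_mem _ _ (O.evenLeft_mem _))
        (Submodule.smul_mem _ _ (O.evenLeft_mem _)))) (O.evenLeft_mem _)

theorem evenOp_upperOp (h2 : (2 : F) ≠ 0)
    (h : Matrix (Fin m) (Fin m) F × Matrix (Fin n) (Fin n) F) (B : Matrix (Fin m) (Fin n) F) :
    O.evenOp h * O.upperOp B - O.upperOp B * O.evenOp h = O.upperOp (h.1 * B - B * h.2) := by
  rw [← sub_eq_zero]
  -- The difference is odd, so it anticommutes with the wedges; the Jacobi identity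
  -- `brOdd_derivation` makes the remaining even terms cancel.
  refine O.eq_zero _ (-1) (fun C => ?_) ?_
  · have hcomm := O.evenOp_commutator h (brOdd m n F B C)
    have e1 := O.upperOp_mul_wedge h2 (h.1 * B - B * h.2) C
    rw [brOdd_derivation, map_sub O.evenOp, ← hcomm] at e1
    rw [sub_mul, e1]
    simp only [sub_mul, mul_sub, mul_assoc, evenOp_mul_wedge, O.upperOp_mul_wedge h2, neg_smul,
      one_smul, mul_add, mul_neg]
    simp only [← mul_assoc, evenOp_mul_wedge, O.upperOp_mul_wedge h2, add_mul, neg_mul]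
    abel
  · exact Submodule.sub_mem _ (Submodule.sub_mem _ (Submodule.smul_mem _ _ (O.upperOp_mem _))
      (O.upperOp_mul_evenOp_mem _ _)) (O.upperOp_mem _)

theorem upperOp_upperOp (h2 : (2 : F) ≠ 0) (B B' : Matrix (Fin m) (Fin n) F) :
    O.upperOp B * O.upperOp B' + O.upperOp B' * O.upperOp B = 0 := by
  refine O.eq_zero _ 1 (fun C => ?_) ?_
  · have e1 := O.evenOp_upperOp h2 (brOdd m n F B C) B'
    have e2 := O.evenOp_upperOp h2 (brOdd m n F B' C) B
    -- Here [[B, C], B'] + [[B', C], B] = 0, which is all that obstructs the anticommutator from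
    -- commuting with C.
    have e3 : (brOdd m n F B C).1 * B' - B' * (brOdd m n F B C).2 +
        ((brOdd m n F B' C).1 * B - B * (brOdd m n F B' C).2) = 0 := by
      simp [brOdd_apply, Matrix.mul_assoc]
    have e4 : (O.evenOp (brOdd m n F B C) * O.upperOp B' -
        O.upperOp B' * O.evenOp (brOdd m n F B C)) +
        (O.evenOp (brOdd m n F B' C) * O.upperOp B -
          O.upperOp B * O.evenOp (brOdd m n F B' C)) = 0 := by
      rw [e1, e2, ← map_add, e3, map_zero]
    rw [← sub_eq_zero, one_smul, ← neg_eq_zero, ← e4]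
    simp only [add_mul, mul_add, mul_assoc, O.upperOp_mul_wedge h2, mul_neg]
    simp only [← mul_assoc, O.upperOp_mul_wedge h2, add_mul, neg_mul]
    abel
  · exact Submodule.add_mem _ (Submodule.smul_mem _ _ (O.upperOp_mem _))
      (Submodule.smul_mem _ _ (O.upperOp_mem _))

/-- The action of `gl(m,n)`. -/
def op : Gl m n F →ₗ[F] R where
  toFun X := O.evenOp (X.toBlocks₁₁, X.toBlocks₂₂) + O.upperOp X.toBlocks₁₂ +
    O.wedge X.toBlocks₂₁
  map_add' X Y := by
    have h : ((X + Y).toBlocks₁₁, (X + Y).toBlocks₂₂) =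
      (X.toBlocks₁₁, X.toBlocks₂₂) + (Y.toBlocks₁₁, Y.toBlocks₂₂) := rfl
    have h' : (X + Y).toBlocks₁₂ = X.toBlocks₁₂ + Y.toBlocks₁₂ := rfl
    have h'' : (X + Y).toBlocks₂₁ = X.toBlocks₂₁ + Y.toBlocks₂₁ := rfl
    rw [h, h', h'', map_add, map_add, map_add]
    abel
  map_smul' c X := by
    have h : ((c • X).toBlocks₁₁, (c • X).toBlocks₂₂) = c • (X.toBlocks₁₁, X.toBlocks₂₂) := rfl
    have h' : (c • X).toBlocks₁₂ = c • X.toBlocks₁₂ := rfl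
    have h'' : (c • X).toBlocks₂₁ = c • X.toBlocks₂₁ := rfl
    rw [h, h', h'', map_smul, map_smul, map_smul, RingHom.id_apply, smul_add, smul_add]

theorem op_fromBlocks (A : Matrix (Fin m) (Fin m) F) (B : Matrix (Fin m) (Fin n) F)
    (C : Matrix (Fin n) (Fin m) F) (D : Matrix (Fin n) (Fin n) F) :
    O.op (Matrix.fromBlocks A B C D) = O.evenOp (A, D) + O.upperOp B + O.wedge C := rfl

theorem op_relation (h2 : (2 : F) ≠ 0)
    {a b : ZMod 2} {X Y : Gl m n F} (hX : X ∈ homog m n F a) (hY : Y ∈ homog m n F b) :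
    O.op X * O.op Y = koszul F a b • (O.op Y * O.op X) + O.op (sbracket X Y) := by
  rw [sbracket_of_mem hX hY]
  have h01 : ∀ c : ZMod 2, c = 0 ∨ c = 1 := by decide
  have k1 : koszul F 1 1 = -1 := by simp [koszul, ZMod.val_one]
  have k0 : ∀ b, koszul F 0 b = 1 := by simp [koszul]
  have k0' : ∀ a, koszul F a 0 = 1 := by simp [koszul]
  rcases h01 a with rfl | rfl <;> rcases h01 b with rfl | rfl
  · obtain ⟨A, D, rfl⟩ := eq_fromBlocks_of_even hX
    obtain ⟨A', D', rfl⟩ := eq_fromBlocks_of_even hY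
    have e := O.evenOp_commutator (A, D) (A', D')
    simp only [Matrix.fromBlocks_multiply, k0, one_smul, fromBlocks_sub_fromBlocks,
      op_fromBlocks, Matrix.mul_zero, Matrix.zero_mul, add_zero, zero_add, sub_zero, map_zero]
    rw [sub_eq_iff_eq_add'] at e
    exact e
  · obtain ⟨A, D, rfl⟩ := eq_fromBlocks_of_even hX
    obtain ⟨B, C, rfl⟩ := eq_fromBlocks_of_odd hY
    have e := O.evenOp_upperOp h2 (A, D) B
    have e' := O.evenOp_mul_wedge (A, D) C
    simp only [Matrix.fromBlocks_multiply, k0, one_smul, fromBlocks_sub_fromBlocks,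
      op_fromBlocks, Matrix.mul_zero, Matrix.zero_mul, add_zero, zero_add, map_zero,
      Prod.mk_zero_zero, sub_self]
    rw [adLower_apply] at e'
    dsimp only at e e'
    rw [mul_add, add_mul, e', ← e]
    abel
  · obtain ⟨A, D, rfl⟩ := eq_fromBlocks_of_even hY
    obtain ⟨B, C, rfl⟩ := eq_fromBlocks_of_odd hX
    have e := O.evenOp_upperOp h2 (A, D) B
    have e' := O.evenOp_mul_wedge (A, D) C
    simp only [Matrix.fromBlocks_multiply, k0', one_smul, fromBlocks_sub_fromBlocks,
      op_fromBlocks, Matrix.mul_zero, Matrix.zero_mul, add_zero, zero_add, map_zero,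
      Prod.mk_zero_zero, sub_self]
    rw [adLower_apply] at e'
    dsimp only at e e'
    have s1 : B * D - A * B = -(A * B - B * D) := by abel
    have s2 : C * A - D * C = -(D * C - C * A) := by abel
    rw [mul_add, add_mul, e', s1, s2, map_neg, map_neg, ← e]
    abel
  · obtain ⟨B, C, rfl⟩ := eq_fromBlocks_of_odd hX
    obtain ⟨B', C', rfl⟩ := eq_fromBlocks_of_odd hY
    have e := O.upperOp_upperOp h2 B B'
    have e1 := O.upperOp_mul_wedge h2 B C'
    have e2 := O.upperOp_mul_wedge h2 B' C
    have e3 := O.wedge_mul_wedge C C'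
    simp only [Matrix.fromBlocks_multiply, k1, neg_smul, one_smul, sub_neg_eq_add,
      Matrix.fromBlocks_add,
      op_fromBlocks, Matrix.mul_zero, Matrix.zero_mul, add_zero, zero_add, map_zero,
      Prod.mk_zero_zero]
    have s1 : (B * C' + B' * C, C * B' + C' * B) = brOdd m n F B C' + brOdd m n F B' C := by
      ext1 <;> simp [brOdd_apply, add_comm]
    rw [s1, map_add]
    simp only [add_mul, mul_add]
    rw [e1, e2, e3, eq_neg_of_add_eq_zero_left e]
    abel

end Oscillator

end Model

end

end GLSuper

namespace GLSuper

noncomputable section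

/-! ### The operators realized on Λ(𝔤_{-1}) ⊗ M -/

section Model

variable {m n : ℕ} {F : Type*} [Field F]

variable (m n F) (M : Type*) [AddCommGroup M] [Module F M]

/-- The space `Λ(𝔤_{-1}) ⊗ M` underlying the explicit model of the Kac module. -/
abbrev Model : Type _ := ExteriorAlgebra F (Matrix (Fin n) (Fin m) F) ⊗[F] M

/-- Exterior multiplication by an element of `𝔤_{-1}`. -/
def wedge : Matrix (Fin n) (Fin m) F →ₗ[F] Module.End F (Model m n F M) :=
  LinearMap.rTensorHom M ∘ₗ LinearMap.mul F (ExteriorAlgebra F (Matrix (Fin n) (Fin m) F)) ∘ₗ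
    ExteriorAlgebra.ι F

/-- Contraction with a coordinate function on `𝔤_{-1}`. -/
def contr (a : Fin n × Fin m) : Module.End F (Model m n F M) :=
  LinearMap.rTensor M (CliffordAlgebra.contractLeft
    (Q := (0 : QuadraticForm F (Matrix (Fin n) (Fin m) F))) (Matrix.entryLinearMap F F a.1 a.2))

variable {m n F M}

theorem wedge_tmul (C : Matrix (Fin n) (Fin m) F)
    (x : ExteriorAlgebra F (Matrix (Fin n) (Fin m) F)) (y : M) :
    wedge m n F M C (x ⊗ₜ y) = (ExteriorAlgebra.ι F C * x) ⊗ₜ y := rfl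

theorem contr_tmul (a : Fin n × Fin m) (x : ExteriorAlgebra F (Matrix (Fin n) (Fin m) F)) (y : M) :
    contr m n F M a (x ⊗ₜ y) = (CliffordAlgebra.contractLeft
    (Q := (0 : QuadraticForm F (Matrix (Fin n) (Fin m) F)))
      (Matrix.entryLinearMap F F a.1 a.2) x) ⊗ₜ y := rfl

theorem contr_one_tmul (a : Fin n × Fin m) (y : M) : contr m n F M a (1 ⊗ₜ y) = 0 := by
  rw [contr_tmul, CliffordAlgebra.contractLeft_one, TensorProduct.zero_tmul]

theorem wedge_mul_wedge (C C' : Matrix (Fin n) (Fin m) F) :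
    wedge m n F M C * wedge m n F M C' = -(wedge m n F M C' * wedge m n F M C) := by
  refine TensorProduct.ext' fun x y => ?_
  simp only [Module.End.mul_apply, LinearMap.neg_apply, wedge_tmul, ← TensorProduct.neg_tmul,
    ← mul_assoc]
  rw [eq_neg_of_add_eq_zero_left (ExteriorAlgebra.ι_add_mul_swap C C'), neg_mul]

theorem contr_mul_wedge (a : Fin n × Fin m) (C : Matrix (Fin n) (Fin m) F) :
    contr m n F M a * wedge m n F M C =
      C a.1 a.2 • 1 - wedge m n F M C * contr m n F M a := by
  refine TensorProduct.ext' fun x y => ?_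
  simp only [Module.End.mul_apply, LinearMap.sub_apply, wedge_tmul, contr_tmul,
    LinearMap.smul_apply, Module.End.one_apply, ExteriorAlgebra.ι]
  rw [CliffordAlgebra.contractLeft_ι_mul, TensorProduct.sub_tmul, TensorProduct.smul_tmul']
  rfl

theorem contr_wedge (a : Fin n × Fin m) (C : Matrix (Fin n) (Fin m) F) (x : Model m n F M) :
    contr m n F M a (wedge m n F M C x) =
      C a.1 a.2 • x - wedge m n F M C (contr m n F M a x) :=
  LinearMap.congr_fun (contr_mul_wedge a C) x

/-- An operator on the model which supercommutes with exterior multiplications is determined by its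
restriction to `1 ⊗ M`. -/
theorem eq_zero_of_comm_wedge {T : Module.End F (Model m n F M)} (c : F)
    (hc : ∀ C, T * wedge m n F M C = c • (wedge m n F M C * T))
    (h1 : ∀ y : M, T (1 ⊗ₜ y) = 0) : T = 0 := by
  refine TensorProduct.ext' fun x y => ?_
  induction x using CliffordAlgebra.left_induction with
  | algebraMap r =>
    rw [Algebra.algebraMap_eq_smul_one, ← TensorProduct.smul_tmul', map_smul, h1]
    simp
  | add x x' hx hx' => rw [TensorProduct.add_tmul, map_add, hx, hx']; simp
  | ι_mul x C hx =>
    have h := LinearMap.congr_fun (hc C) (x ⊗ₜ y)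
    simp only [Module.End.mul_apply, LinearMap.smul_apply] at h
    rw [hx, LinearMap.zero_apply, map_zero, smul_zero, wedge_tmul] at h
    exact h

variable (T : (Matrix (Fin m) (Fin m) F × Matrix (Fin n) (Fin n) F) →ₗ[F] Module.End F M)

/-- The action of the even part on the second factor of the model. -/
def evenRight :
    (Matrix (Fin m) (Fin m) F × Matrix (Fin n) (Fin n) F) →ₗ[F] Module.End F (Model m n F M) :=
  LinearMap.lTensorHom _ ∘ₗ T

theorem evenRight_mul_wedge (h : Matrix (Fin m) (Fin m) F × Matrix (Fin n) (Fin n) F)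
    (C : Matrix (Fin n) (Fin m) F) :
    evenRight T h * wedge m n F M C = wedge m n F M C * evenRight T h :=
  TensorProduct.ext' fun _ _ => rfl

/-- The projection of the model onto `1 ⊗ M`. -/
def modelProj (m n : ℕ) (F : Type*) [Field F] (M : Type*) [AddCommGroup M] [Module F M] :
    Model m n F M →ₗ[F] M :=
  (TensorProduct.lid F M).toLinearMap ∘ₗ
    LinearMap.rTensor M (ExteriorAlgebra.algebraMapInv (R := F)
      (M := Matrix (Fin n) (Fin m) F)).toLinearMap

theorem modelProj_one_tmul (y : M) : modelProj m n F M (1 ⊗ₜ y) = y := by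
  simp [modelProj]

theorem modelProj_wedge (C : Matrix (Fin n) (Fin m) F) (x : Model m n F M) :
    modelProj m n F M (wedge m n F M C x) = 0 := by
  induction x using TensorProduct.induction_on with
  | zero => rw [map_zero, map_zero]
  | add x y hx hy => rw [map_add, map_add, hx, hy, add_zero]
  | tmul x y =>
    rw [wedge_tmul]
    simp [modelProj, ExteriorAlgebra.algebraMapInv]

theorem contr_wedge_prod {a : Fin n × Fin m} {l : List (Fin n × Fin m)} (ha : a ∉ l) (y : M) :
    contr m n F M a ((l.map fun b => wedge m n F M (Matrix.single b.1 b.2 1)).prod (1 ⊗ₜ y)) =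
      0 := by
  induction l with
  | nil => simp [contr_one_tmul]
  | cons b l ih =>
    rw [List.mem_cons, not_or] at ha
    have hab : Matrix.single b.1 b.2 (1 : F) a.1 a.2 = 0 := by
      rw [Matrix.single_apply, if_neg]
      rintro ⟨h1, h2⟩
      exact ha.1 (Prod.ext h1.symm h2.symm)
    rw [List.map_cons, List.prod_cons, Module.End.mul_apply, contr_wedge, hab, zero_smul,
      ih ha.2, map_zero, sub_zero]

/-- Contraction with the coordinate of the first factor strips that factor off, since the remaining
ones are distinct from it; the induction ends at 1 ⊗ y, which `modelProj` detects. -/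
theorem wedge_prod_ne_zero {l : List (Fin n × Fin m)} (hl : l.Nodup) {y : M} (hy : y ≠ 0) :
    (l.map fun b => wedge m n F M (Matrix.single b.1 b.2 1)).prod (1 ⊗ₜ y) ≠ 0 := by
  induction l with
  | nil =>
    intro h
    apply hy
    rw [← modelProj_one_tmul (m := m) (n := n) (F := F) y]
    simpa using congrArg (modelProj m n F M) h
  | cons b l ih =>
    rw [List.nodup_cons] at hl
    intro h
    apply ih hl.2
    have h' := congrArg (contr m n F M b) h
    rw [List.map_cons, List.prod_cons, Module.End.mul_apply, contr_wedge, contr_wedge_prod hl.1,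
      map_zero, map_zero, Matrix.single_apply_same, one_smul, sub_zero] at h'
    exact h'

/-- The oscillator operators on the model. -/
def modelOscillator (hT : ∀ h h', T h * T h' - T h' * T h = T (h * h' - h' * h)) :
    Oscillator m n F (Module.End F (Model m n F M)) where
  wedge := wedge m n F M
  contr := contr m n F M
  evenRight := evenRight T
  vac :=
    { carrier := {S | ∀ y : M, S (1 ⊗ₜ y) = 0}
      add_mem' := fun {S S'} hS hS' y => by rw [LinearMap.add_apply, hS, hS', add_zero]
      zero_mem' := fun _ => rfl
      smul_mem' := fun S S' hS' y => by
        rw [smul_eq_mul, Module.End.mul_apply, hS', map_zero] }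
  wedge_mul_wedge := wedge_mul_wedge
  contr_mul_wedge := contr_mul_wedge
  evenRight_mul_wedge := evenRight_mul_wedge T
  contr_mul_evenRight a h := TensorProduct.ext' fun _ _ => rfl
  evenRight_commutator h h' := TensorProduct.ext' fun x y => by
    change _ = x ⊗ₜ T (h * h' - h' * h) y
    rw [← hT]
    exact (TensorProduct.tmul_sub x (T h (T h' y)) (T h' (T h y))).symm
  contr_mem := contr_one_tmul
  eq_zero _ c hc h := eq_zero_of_comm_wedge c hc h

end Model

/-! ### The action of U(𝔤) on the model and the map from the Kac module -/

section Rep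

variable {m n : ℕ} {F : Type*} [Field F]

theorem U.induction (S : SubSuper m n F) {P : U S → Prop} (hF : ∀ r : F, P (algebraMap F _ r))
    (hι : ∀ x, P (U.ι S x)) (hmul : ∀ u w, P u → P w → P (u * w))
    (hadd : ∀ u w, P u → P w → P (u + w)) (u : U S) : P u := by
  obtain ⟨t, rfl⟩ : ∃ t, U.mk S t = u := RingQuot.mkAlgHom_surjective F (URel S) u
  induction t using TensorAlgebra.induction with
  | algebraMap r => rw [AlgHom.commutes]; exact hF r
  | ι x => exact hι x
  | mul a b ha hb => rw [map_mul]; exact hmul _ _ ha hb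
  | add a b ha hb => rw [map_add]; exact hadd _ _ ha hb

/-- Block diagonal matrices as elements of the even part. -/
def evenIncl (m n : ℕ) (F : Type*) [Field F] :
    (Matrix (Fin m) (Fin m) F × Matrix (Fin n) (Fin n) F) →ₗ[F] (gEven m n F).carrier where
  toFun h := ⟨Matrix.fromBlocks h.1 0 0 h.2, by
    rintro (i | i) (j | j) hij
    · simp [par] at hij
    · rfl
    · rfl
    · exact absurd rfl hij⟩
  map_add' h h' := Subtype.ext (by simp [Matrix.fromBlocks_add])
  map_smul' c h := Subtype.ext (by simp [Matrix.fromBlocks_smul])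

variable (m n F) (M : Type*) [AddCommGroup M] [Module F M] [Module (U (gEven m n F)) M]
  [IsScalarTower F (U (gEven m n F)) M]

/-- The representation of `𝔤_0` on `M`, in block coordinates. -/
def coeffRep : (Matrix (Fin m) (Fin m) F × Matrix (Fin n) (Fin n) F) →ₗ[F] Module.End F M :=
  (Algebra.lsmul F F M (A := U (gEven m n F))).toLinearMap ∘ₗ U.ι (gEven m n F) ∘ₗ
    evenIncl m n F

theorem coeffRep_apply (h : Matrix (Fin m) (Fin m) F × Matrix (Fin n) (Fin n) F) (y : M) :
    coeffRep m n F M h y = U.ι (gEven m n F) (evenIncl m n F h) • y := rfl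

theorem coeffRep_commutator (h h' : Matrix (Fin m) (Fin m) F × Matrix (Fin n) (Fin n) F) :
    coeffRep m n F M h * coeffRep m n F M h' - coeffRep m n F M h' * coeffRep m n F M h =
      coeffRep m n F M (h * h' - h' * h) := by
  have e := U.ι_mul (gEven m n F) 0 0 (evenIncl m n F h) (evenIncl m n F h')
    (evenIncl m n F h).2 (evenIncl m n F h').2
  have e2 : (⟨sbracket (evenIncl m n F h : Gl m n F) (evenIncl m n F h'),
      (gEven m n F).bracket_mem _ (evenIncl m n F h).2 _ (evenIncl m n F h').2⟩ :
        (gEven m n F).carrier) = evenIncl m n F (h * h' - h' * h) := by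
    apply Subtype.ext
    change sbracket (evenIncl m n F h : Gl m n F) (evenIncl m n F h') = _
    rw [sbracket_of_mem (evenIncl m n F h).2 (evenIncl m n F h').2]
    simp [evenIncl, koszul, Matrix.fromBlocks_multiply, fromBlocks_sub_fromBlocks]
  rw [e2] at e
  ext y
  rw [LinearMap.sub_apply, Module.End.mul_apply, Module.End.mul_apply]
  simp only [coeffRep_apply, ← mul_smul]
  rw [e, add_smul]
  simp [koszul]

/-- The oscillator operators on `Λ(𝔤_{-1}) ⊗ M`. -/
def kacOscillator : Oscillator m n F (Module.End F (Model m n F M)) :=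
  modelOscillator (coeffRep m n F M) (coeffRep_commutator m n F M)

/-- The action of `U(𝔤)` on the model. -/
def modelRep (h2 : (2 : F) ≠ 0) : U (gFull m n F) →ₐ[F] Module.End F (Model m n F M) :=
  U.lift (gFull m n F) ((kacOscillator m n F M).op ∘ₗ (gFull m n F).carrier.subtype)
    (fun _ _ _ _ hx hy => (kacOscillator m n F M).op_relation h2 hx hy)

variable {m n F M}

theorem modelRep_ι (h2 : (2 : F) ≠ 0) (x : (gFull m n F).carrier) :
    modelRep m n F M h2 (U.ι _ x) = (kacOscillator m n F M).op x :=
  U.lift_ι _ _ _ _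

theorem inclU_ι (x : (gPlus m n F).carrier) :
    inclU m n F (U.ι _ x) = U.ι (gFull m n F) ⟨x, trivial⟩ :=
  U.lift_ι _ _ _ _

theorem projU_ι (x : (gPlus m n F).carrier) :
    projU m n F (U.ι _ x) = U.ι (gEven m n F) (gPlusProj m n F x) :=
  U.lift_ι _ _ _ _

theorem Oscillator.op_one_tmul (X : Gl m n F) (hX : X ∈ (gPlus m n F).carrier) (y : M) :
    (kacOscillator m n F M).op X (1 ⊗ₜ y) =
      1 ⊗ₜ (U.ι (gEven m n F) (gPlusProj m n F ⟨X, hX⟩) • y) := by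
  have h21 : X.toBlocks₂₁ = 0 := by
    ext i j
    exact hX i j
  have hp : gPlusProj m n F ⟨X, hX⟩ = evenIncl m n F (X.toBlocks₁₁, X.toBlocks₂₂) := by
    apply Subtype.ext
    ext (i | i) (j | j)
    · simp [gPlusProj, proj, evenIncl, par, Matrix.toBlocks₁₁]
    · simp [gPlusProj, proj, evenIncl, par]
    · simp [gPlusProj, proj, evenIncl, par]
    · have : (1 + 1 : ZMod 2) = 0 := rfl
      simp [gPlusProj, proj, evenIncl, par, Matrix.toBlocks₂₂, this]
  have h12 : (kacOscillator m n F M).upperOp X.toBlocks₁₂ (1 ⊗ₜ y) = 0 :=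
    (kacOscillator m n F M).upperOp_mem _ y
  have hl : (kacOscillator m n F M).evenLeft (X.toBlocks₁₁, X.toBlocks₂₂) (1 ⊗ₜ y) = 0 :=
    (kacOscillator m n F M).evenLeft_mem _ y
  have hop : (kacOscillator m n F M).op X =
    (kacOscillator m n F M).evenOp (X.toBlocks₁₁, X.toBlocks₂₂) +
      (kacOscillator m n F M).upperOp X.toBlocks₁₂ +
        (kacOscillator m n F M).wedge X.toBlocks₂₁ := rfl
  have hev : (kacOscillator m n F M).evenOp (X.toBlocks₁₁, X.toBlocks₂₂) =
    (kacOscillator m n F M).evenRight (X.toBlocks₁₁, X.toBlocks₂₂) +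
      (kacOscillator m n F M).evenLeft (X.toBlocks₁₁, X.toBlocks₂₂) := rfl
  rw [hop, h21, map_zero, add_zero, LinearMap.add_apply, h12, add_zero, hev, LinearMap.add_apply,
    hl, add_zero, hp]
  rfl

/-- This compatibility is what lets the map u ⊗ y ↦ u(1 ⊗ y) descend to the tensor product over
U(𝔤⁺). -/
theorem modelRep_inclU (h2 : (2 : F) ≠ 0) (a : U (gPlus m n F)) (y : M) :
    modelRep m n F M h2 (inclU m n F a) (1 ⊗ₜ y) = 1 ⊗ₜ (projU m n F a • y) := by
  induction a using U.induction generalizing y with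
  | hF r =>
    simp only [AlgHom.commutes, Module.algebraMap_end_apply, algebraMap_smul]
    rw [TensorProduct.tmul_smul]
  | hι x => rw [inclU_ι, modelRep_ι, projU_ι, Oscillator.op_one_tmul]
  | hmul u w hu hw =>
    rw [map_mul, map_mul, Module.End.mul_apply, hw, hu, map_mul, mul_smul]
  | hadd u w hu hw =>
    rw [map_add, map_add, LinearMap.add_apply, hw, hu, map_add, add_smul, TensorProduct.tmul_add]

/-- The map `u ⊗ y ↦ u (1 ⊗ y)` to the model. -/
def tensorToModel (h2 : (2 : F) ≠ 0) : U (gFull m n F) ⊗[F] M →ₗ[F] Model m n F M :=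
  TensorProduct.lift ((LinearMap.lcomp F _ (TensorProduct.mk F _ M 1)) ∘ₗ
    (modelRep m n F M h2).toLinearMap)

theorem tensorToModel_tmul (h2 : (2 : F) ≠ 0) (u : U (gFull m n F)) (y : M) :
    tensorToModel h2 (u ⊗ₜ y) = modelRep m n F M h2 u (1 ⊗ₜ y) := rfl

theorem tensorToModel_smul (h2 : (2 : F) ≠ 0) (u : U (gFull m n F))
    (t : U (gFull m n F) ⊗[F] M) :
    tensorToModel h2 (u • t) = modelRep m n F M h2 u (tensorToModel h2 t) := by
  induction t using TensorProduct.induction_on with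
  | zero => simp only [smul_zero, map_zero]
  | add x y hx hy => rw [smul_add, map_add, map_add, map_add, hx, hy]
  | tmul w y =>
    rw [TensorProduct.smul_tmul', tensorToModel_tmul, tensorToModel_tmul, smul_eq_mul, map_mul,
      Module.End.mul_apply]

theorem tensorToModel_kacRel (h2 : (2 : F) ≠ 0) {t : U (gFull m n F) ⊗[F] M}
    (ht : t ∈ kacRel m n F M) : tensorToModel h2 t = 0 := by
  refine Submodule.span_induction (p := fun t _ => tensorToModel h2 t = 0) ?_ ?_ ?_ ?_ ht
  · rintro _ ⟨u, a, x, rfl⟩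
    rw [map_sub, tensorToModel_tmul, tensorToModel_tmul, map_mul, Module.End.mul_apply,
      modelRep_inclU, sub_self]
  · exact map_zero _
  · intro x y _ _ hx hy
    rw [map_add, hx, hy, add_zero]
  · intro u x _ hx
    rw [tensorToModel_smul, hx, map_zero]

/-- The canonical map from the Kac module to the model. -/
def kacToModel (h2 : (2 : F) ≠ 0) : Kac m n F M →ₗ[F] Model m n F M :=
  ((kacRel m n F M).restrictScalars F).liftQ (tensorToModel h2)
    (fun _ ht => tensorToModel_kacRel h2 ht) ∘ₗ
      (Submodule.Quotient.restrictScalarsEquiv F (kacRel m n F M)).symm.toLinearMap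

theorem kacToModel_mk (h2 : (2 : F) ≠ 0) (t : U (gFull m n F) ⊗[F] M) :
    kacToModel h2 ((kacRel m n F M).mkQ t) = tensorToModel h2 t := rfl

theorem kacToModel_smul (h2 : (2 : F) ≠ 0) (u : U (gFull m n F)) (x : Kac m n F M) :
    kacToModel h2 (u • x) = modelRep m n F M h2 u (kacToModel h2 x) := by
  obtain ⟨t, rfl⟩ := (kacRel m n F M).mkQ_surjective x
  rw [← map_smul, kacToModel_mk, kacToModel_mk, tensorToModel_smul]

end Rep

end

end GLSuper

namespace GLSuper

noncomputable section

/-! ### Matrix units in U(𝔤) and the spanning half of PBW -/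

section Enveloping

variable {m n : ℕ} {F : Type*} [Field F]

/-- The canonical map `gl(m,n) → U(gl(m,n))`. -/
def gen : Gl m n F →ₗ[F] U (gFull m n F) :=
  U.ι (gFull m n F) ∘ₗ LinearMap.codRestrict (gFull m n F).carrier LinearMap.id fun _ => trivial

theorem gen_mul_gen {a b : ZMod 2} {X Y : Gl m n F} (hX : X ∈ homog m n F a)
    (hY : Y ∈ homog m n F b) :
    gen X * gen Y = koszul F a b • (gen Y * gen X) + gen (X * Y - koszul F a b • (Y * X)) := by
  rw [← sbracket_of_mem hX hY]
  exact U.ι_mul (gFull m n F) a b ⟨X, trivial⟩ ⟨Y, trivial⟩ hX hY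

theorem gen_even_mul {b : ZMod 2} {X Y : Gl m n F} (hX : X ∈ homog m n F 0)
    (hY : Y ∈ homog m n F b) : gen X * gen Y = gen Y * gen X + gen (X * Y - Y * X) := by
  simpa [koszul] using gen_mul_gen hX hY

theorem gen_odd_mul {X Y : Gl m n F} (hX : X ∈ homog m n F 1) (hY : Y ∈ homog m n F 1) :
    gen X * gen Y = -(gen Y * gen X) + gen (X * Y + Y * X) := by
  simpa [koszul, ZMod.val_one] using gen_mul_gen hX hY

theorem single_mem_homog (i j : Idx m n) (c : F) :
    Matrix.single i j c ∈ homog m n F (par i + par j) := by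
  intro k l hkl
  rw [Matrix.single_apply, if_neg]
  rintro ⟨rfl, rfl⟩
  exact hkl rfl

/-- The matrix unit `e_{ji}`, `i ≤ m < j`, in `U(𝔤)`. -/
def lower (a : Fin n × Fin m) : U (gFull m n F) :=
  gen (Matrix.single (Sum.inr a.1) (Sum.inl a.2) 1)

/-- The matrix unit `e_{ij}`, `i ≤ m < j`, in `U(𝔤)`. -/
def upper (a : Fin n × Fin m) : U (gFull m n F) :=
  gen (Matrix.single (Sum.inl a.2) (Sum.inr a.1) 1)

theorem lowerUnit_mem (j : Fin n) (i : Fin m) (c : F) :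
    Matrix.single (Sum.inr j) (Sum.inl i) c ∈ homog m n F 1 :=
  single_mem_homog (Sum.inr j) (Sum.inl i) c

theorem upperUnit_mem (i : Fin m) (j : Fin n) (c : F) :
    Matrix.single (Sum.inl i) (Sum.inr j) c ∈ homog m n F 1 :=
  single_mem_homog (Sum.inl i) (Sum.inr j) c

theorem leftUnit_mem (i i' : Fin m) (c : F) :
    Matrix.single (Sum.inl i) (Sum.inl i') c ∈ homog m n F 0 :=
  single_mem_homog (Sum.inl i) (Sum.inl i') c

theorem rightUnit_mem (j j' : Fin n) (c : F) :
    Matrix.single (Sum.inr j) (Sum.inr j') c ∈ homog m n F 0 :=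
  single_mem_homog (Sum.inr j) (Sum.inr j') c

theorem mul_self_eq_zero_of_anti (h2 : (2 : F) ≠ 0) {u : U (gFull m n F)} (h : u * u = -(u * u)) :
    u * u = 0 := by
  have h' : (2 : F) • (u * u) = 0 := by
    rw [two_smul]
    nth_rw 2 [h]
    exact add_neg_cancel _
  exact (smul_eq_zero.1 h').resolve_left h2

theorem lower_mul_lower (a b : Fin n × Fin m) :
    (lower a : U (gFull m n F)) * lower b = -(lower b * lower a) := by
  rw [lower, lower, gen_odd_mul (lowerUnit_mem _ _ _) (lowerUnit_mem _ _ _)]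
  simp

theorem upper_mul_upper (a b : Fin n × Fin m) :
    (upper a : U (gFull m n F)) * upper b = -(upper b * upper a) := by
  rw [upper, upper, gen_odd_mul (upperUnit_mem _ _ _) (upperUnit_mem _ _ _)]
  simp

theorem anticommuting_lower (h2 : (2 : F) ≠ 0) :
    Anticommuting (lower : Fin n × Fin m → U (gFull m n F)) :=
  ⟨fun a => mul_self_eq_zero_of_anti h2 (lower_mul_lower a a), lower_mul_lower⟩

theorem anticommuting_upper (h2 : (2 : F) ≠ 0) :
    Anticommuting (upper : Fin n × Fin m → U (gFull m n F)) :=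
  ⟨fun a => mul_self_eq_zero_of_anti h2 (upper_mul_upper a a), upper_mul_upper⟩

theorem left_mul_lower (i i' k : Fin m) (j : Fin n) :
    gen (Matrix.single (Sum.inl i) (Sum.inl i') (1 : F)) * lower (j, k) =
      lower (j, k) * gen (Matrix.single (Sum.inl i) (Sum.inl i') 1) -
        if k = i then lower (j, i') else 0 := by
  rw [lower, gen_even_mul (leftUnit_mem _ _ _) (lowerUnit_mem _ _ _)]
  by_cases h : k = i
  · subst h
    simp [lower, sub_eq_add_neg]
  · simp [h]

theorem right_mul_lower (j j' k : Fin n) (i : Fin m) :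
    gen (Matrix.single (Sum.inr j) (Sum.inr j') (1 : F)) * lower (k, i) =
      lower (k, i) * gen (Matrix.single (Sum.inr j) (Sum.inr j') 1) +
        if j' = k then lower (j, i) else 0 := by
  rw [lower, gen_even_mul (rightUnit_mem _ _ _) (lowerUnit_mem _ _ _)]
  by_cases h : j' = k
  · subst h
    simp [lower]
  · simp [h]

theorem upper_mul_lower (j j' : Fin n) (i i' : Fin m) :
    (upper (j, i) : U (gFull m n F)) * lower (j', i') = -(lower (j', i') * upper (j, i)) +
      ((if j = j' then gen (Matrix.single (Sum.inl i) (Sum.inl i') 1) else 0) +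
        if i' = i then gen (Matrix.single (Sum.inr j') (Sum.inr j) 1) else 0) := by
  rw [upper, lower, gen_odd_mul (upperUnit_mem _ _ _) (lowerUnit_mem _ _ _), map_add]
  congr 2
  · by_cases h : j = j'
    · subst h; simp
    · simp [h]
  · by_cases h : i' = i
    · subst h; simp
    · simp [h]

theorem gen_lower_mem_span (C : Matrix (Fin n) (Fin m) F) :
    gen (Matrix.fromBlocks 0 0 C 0) ∈
      Submodule.span F (Set.range (lower (m := m) (n := n) (F := F))) := by
  have h : Matrix.fromBlocks 0 0 C 0 = ∑ j, ∑ i,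
      C j i • (Matrix.single (Sum.inr j) (Sum.inl i) 1 : Gl m n F) := by
    rw [Matrix.matrix_eq_sum_single (Matrix.fromBlocks 0 0 C 0)]
    simp [Fintype.sum_sum_type]
  rw [h]
  simp only [map_sum, map_smul]
  exact Submodule.sum_mem _ fun j _ => Submodule.sum_mem _ fun i _ =>
    Submodule.smul_mem _ _ (Submodule.subset_span ⟨(j, i), rfl⟩)

theorem gen_upper_mem_span (B : Matrix (Fin m) (Fin n) F) :
    gen (Matrix.fromBlocks 0 B 0 0) ∈
      Submodule.span F (Set.range (upper (m := m) (n := n) (F := F))) := by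
  have h : Matrix.fromBlocks 0 B 0 0 = ∑ j, ∑ i,
      B i j • (Matrix.single (Sum.inl i) (Sum.inr j) 1 : Gl m n F) := by
    rw [Matrix.matrix_eq_sum_single (Matrix.fromBlocks 0 B 0 0), Finset.sum_comm]
    simp [Fintype.sum_sum_type]
  rw [h]
  simp only [map_sum, map_smul]
  exact Submodule.sum_mem _ fun j _ => Submodule.sum_mem _ fun i _ =>
    Submodule.smul_mem _ _ (Submodule.subset_span ⟨(j, i), rfl⟩)

theorem lowerUnit_eq (j : Fin n) (i : Fin m) :
    (Matrix.single (Sum.inr j) (Sum.inl i) 1 : Gl m n F) =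
      Matrix.fromBlocks 0 0 (Matrix.single j i 1) 0 := by
  ext (k | k) (l | l) <;> simp [Matrix.single_apply]

theorem upperUnit_eq (i : Fin m) (j : Fin n) :
    (Matrix.single (Sum.inl i) (Sum.inr j) 1 : Gl m n F) =
      Matrix.fromBlocks 0 (Matrix.single i j 1) 0 0 := by
  ext (k | k) (l | l) <;> simp [Matrix.single_apply]

theorem gen_even_commutator_lower {X : Gl m n F} (hX : X ∈ homog m n F 0) (a : Fin n × Fin m) :
    gen X * lower a - lower a * gen X ∈ Submodule.span F (Set.range lower) := by
  rw [lower, gen_even_mul hX (lowerUnit_mem _ _ _), add_sub_cancel_left, lowerUnit_eq]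
  obtain ⟨A, D, rfl⟩ := eq_fromBlocks_of_even hX
  rw [Matrix.fromBlocks_multiply, Matrix.fromBlocks_multiply, fromBlocks_sub_fromBlocks]
  simpa using gen_lower_mem_span _

theorem gen_even_commutator_upper {X : Gl m n F} (hX : X ∈ homog m n F 0) (a : Fin n × Fin m) :
    gen X * upper a - upper a * gen X ∈ Submodule.span F (Set.range upper) := by
  rw [upper, gen_even_mul hX (upperUnit_mem _ _ _), add_sub_cancel_left, upperUnit_eq]
  obtain ⟨A, D, rfl⟩ := eq_fromBlocks_of_even hX
  rw [Matrix.fromBlocks_multiply, Matrix.fromBlocks_multiply, fromBlocks_sub_fromBlocks]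
  simpa using gen_upper_mem_span _

theorem gen_odd_anticommutator {X : Gl m n F} (hX : X ∈ homog m n F 1)
    (a : Fin n × Fin m) :
    ∃ Y ∈ homog m n F 0, gen X * lower a = -(lower a * gen X) + gen Y :=
  ⟨_, by
    have h1 := mul_mem_homog hX (lowerUnit_mem a.1 a.2 (1 : F))
    have h2 := mul_mem_homog (lowerUnit_mem a.1 a.2 (1 : F)) hX
    exact Submodule.add_mem _ h1 h2, gen_odd_mul hX (lowerUnit_mem a.1 a.2 1)⟩

theorem gen_eq_inclU (X : Gl m n F) (hX : X ∈ (gPlus m n F).carrier) :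
    gen X = inclU m n F (U.ι _ ⟨X, hX⟩) :=
  (inclU_ι ⟨X, hX⟩).symm

theorem even_mem_gPlus {X : Gl m n F} (hX : X ∈ homog m n F 0) : X ∈ (gPlus m n F).carrier :=
  fun i j => hX _ _ (by simp [par])

variable (m n F) in
/-- The span of the products of at least `k` elements of `𝔤_{-1}` with an element of `U(𝔤⁺)`. -/
def lowerFiltration (k : ℕ) : Submodule F (U (gFull m n F)) :=
  Submodule.span F {u | ∃ (l : List (Fin n × Fin m)) (p : U (gPlus m n F)), k ≤ l.length ∧
    u = (l.map lower).prod * inclU m n F p}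

theorem mul_mem_of_span {S T : Submodule F (U (gFull m n F))} {s : Set (U (gFull m n F))}
    {u : U (gFull m n F)} (hS : S = Submodule.span F s) (h : ∀ w ∈ s, u * w ∈ T)
    {w : U (gFull m n F)} (hw : w ∈ S) : u * w ∈ T := by
  subst hS
  exact (Submodule.span_le (p := T.comap (LinearMap.mulLeft F u))).2 h hw

theorem mul_mem_of_mem_span {T : Submodule F (U (gFull m n F))} {s : Set (U (gFull m n F))}
    {u : U (gFull m n F)} (h : ∀ w ∈ s, w * u ∈ T)
    {w : U (gFull m n F)} (hw : w ∈ Submodule.span F s) : w * u ∈ T :=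
  (Submodule.span_le (p := T.comap (LinearMap.mulRight F u))).2 h hw

theorem lowerFiltration_anti {k k' : ℕ} (h : k ≤ k') :
    lowerFiltration m n F k' ≤ lowerFiltration m n F k := by
  refine Submodule.span_mono ?_
  rintro u ⟨l, p, hl, rfl⟩
  exact ⟨l, p, h.trans hl, rfl⟩

theorem lower_mul_mem_filtration (a : Fin n × Fin m) {k : ℕ} {u : U (gFull m n F)}
    (hu : u ∈ lowerFiltration m n F k) : lower a * u ∈ lowerFiltration m n F (k + 1) := by
  refine mul_mem_of_span rfl ?_ hu
  rintro _ ⟨l, p, hl, rfl⟩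
  exact Submodule.subset_span ⟨a :: l, p, by simpa using hl, by simp [mul_assoc]⟩

theorem even_mul_mem_filtration {X : Gl m n F} (hX : X ∈ homog m n F 0) {k : ℕ}
    {u : U (gFull m n F)} (hu : u ∈ lowerFiltration m n F k) :
    gen X * u ∈ lowerFiltration m n F k := by
  refine mul_mem_of_span rfl ?_ hu
  rintro _ ⟨l, p, hl, rfl⟩
  have h := commutator_prod_mem_span (F := F) (gen_even_commutator_lower hX) l
  have e : gen X * ((l.map lower).prod * inclU m n F p) =
      (gen X * (l.map lower).prod - (l.map lower).prod * gen X) * inclU m n F p +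
        (l.map lower).prod * inclU m n F (U.ι _ ⟨X, even_mem_gPlus hX⟩ * p) := by
    rw [map_mul, ← gen_eq_inclU]
    noncomm_ring
  rw [e]
  refine Submodule.add_mem _ (mul_mem_of_mem_span ?_ h) (Submodule.subset_span ⟨l, _, hl, rfl⟩)
  rintro _ ⟨l', hl', rfl⟩
  exact Submodule.subset_span ⟨l', p, by omega, rfl⟩

/-- Anticommuting X past a lowering factor either keeps the factor or trades it for an even element,
which preserves the filtration; so at most one factor is lost. Truncated subtraction makes the case
k = 0 say that the bottom step is stable under 𝔤_1. -/
theorem upper_mul_mem_filtration {X : Gl m n F} (hX : X ∈ homog m n F 1)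
    (hX' : X ∈ (gPlus m n F).carrier) {k : ℕ} {u : U (gFull m n F)}
    (hu : u ∈ lowerFiltration m n F k) :
    gen X * u ∈ lowerFiltration m n F (k - 1) := by
  refine mul_mem_of_span rfl ?_ hu
  rintro _ ⟨l, p, hl, rfl⟩
  refine lowerFiltration_anti (Nat.sub_le_sub_right hl 1) ?_
  clear hl
  induction l with
  | nil =>
    refine Submodule.subset_span ⟨[], U.ι _ ⟨X, hX'⟩ * p, by simp, ?_⟩
    simp [gen_eq_inclU X hX']
  | cons a l ih =>
    obtain ⟨Y, hY, hXY⟩ := gen_odd_anticommutator hX a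
    rw [List.map_cons, List.prod_cons, mul_assoc, ← mul_assoc, hXY, add_mul, neg_mul, mul_assoc]
    have hl : ∀ l : List (Fin n × Fin m), (l.map lower).prod * inclU m n F p ∈
        lowerFiltration m n F l.length := fun l => Submodule.subset_span ⟨l, p, le_rfl, rfl⟩
    refine Submodule.add_mem _ (Submodule.neg_mem _ ?_) (even_mul_mem_filtration hY (hl l))
    rw [List.length_cons, Nat.add_sub_cancel]
    exact lowerFiltration_anti (by omega) (lower_mul_mem_filtration a ih)

theorem gen_mul_mem_filtration (X : Gl m n F) {u : U (gFull m n F)}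
    (hu : u ∈ lowerFiltration m n F 0) : gen X * u ∈ lowerFiltration m n F 0 := by
  have e : X = Matrix.fromBlocks X.toBlocks₁₁ 0 0 X.toBlocks₂₂ +
      Matrix.fromBlocks 0 X.toBlocks₁₂ 0 0 + Matrix.fromBlocks 0 0 X.toBlocks₂₁ 0 := by
    conv_lhs => rw [← Matrix.fromBlocks_toBlocks X]
    simp [Matrix.fromBlocks_add]
  rw [e, map_add, map_add, add_mul, add_mul]
  refine Submodule.add_mem _ (Submodule.add_mem _ ?_ ?_) ?_
  · exact even_mul_mem_filtration (evenIncl m n F (X.toBlocks₁₁, X.toBlocks₂₂)).2 hu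
  · refine mul_mem_of_mem_span ?_ (gen_upper_mem_span _)
    rintro _ ⟨a, rfl⟩
    have h : (Matrix.single (Sum.inl a.2) (Sum.inr a.1) 1 : Gl m n F) ∈ (gPlus m n F).carrier :=
      fun i j => by simp
    exact upper_mul_mem_filtration (k := 0) (upperUnit_mem a.2 a.1 1) h hu
  · refine mul_mem_of_mem_span ?_ (gen_lower_mem_span _)
    rintro _ ⟨a, rfl⟩
    exact lowerFiltration_anti (Nat.zero_le _) (lower_mul_mem_filtration a hu)

/-- `U(𝔤) = Λ(𝔤_{-1}) U(𝔤⁺)`. -/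
theorem lowerFiltration_zero : lowerFiltration m n F 0 = ⊤ := by
  have key : ∀ u w : U (gFull m n F), w ∈ lowerFiltration m n F 0 →
      u * w ∈ lowerFiltration m n F 0 := by
    intro u
    induction u using U.induction with
    | hF r =>
      intro w hw
      rw [← Algebra.smul_def]
      exact Submodule.smul_mem _ _ hw
    | hι x => exact fun w hw => gen_mul_mem_filtration x.1 hw
    | hmul u u' hu hu' =>
      intro w hw
      rw [mul_assoc]
      exact hu _ (hu' _ hw)
    | hadd u u' hu hu' =>
      intro w hw
      rw [add_mul]
      exact Submodule.add_mem _ (hu _ hw) (hu' _ hw)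
  rw [eq_top_iff]
  intro u _
  rw [← mul_one u]
  exact key u 1 (Submodule.subset_span ⟨[], 1, le_rfl, by simp⟩)

end Enveloping

/-! ### The vectors 1 ⊗ y and the projection onto them -/

section Vacuum

variable {m n : ℕ} {F : Type*} [Field F]
variable {M : Type*} [AddCommGroup M] [Module F M] [Module (U (gEven m n F)) M]

variable (m n F M) in
/-- The map `y ↦ 1 ⊗ y` from `M` to the Kac module. -/
def vacuum : M →ₗ[F] Kac m n F M :=
  (kacRel m n F M).mkQ.restrictScalars F ∘ₗ TensorProduct.mk F (U (gFull m n F)) M 1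

theorem smul_vacuum (u : U (gFull m n F)) (y : M) :
    u • vacuum m n F M y = (kacRel m n F M).mkQ (u ⊗ₜ y) := by
  change u • (kacRel m n F M).mkQ (1 ⊗ₜ y) = _
  rw [← map_smul, TensorProduct.smul_tmul', smul_eq_mul, mul_one]

theorem inclU_smul_vacuum (p : U (gPlus m n F)) (y : M) :
    inclU m n F p • vacuum m n F M y = vacuum m n F M (projU m n F p • y) := by
  rw [smul_vacuum]
  change _ = (kacRel m n F M).mkQ (1 ⊗ₜ _)
  rw [← sub_eq_zero, ← map_sub, Submodule.mkQ_apply, Submodule.Quotient.mk_eq_zero]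
  exact Submodule.subset_span ⟨1, p, y, by rw [one_mul]⟩

theorem gen_even_smul_vacuum {X : Gl m n F} (hX : X ∈ homog m n F 0) (y : M) :
    gen X • vacuum m n F M y = vacuum m n F M (U.ι (gEven m n F) ⟨X, hX⟩ • y) := by
  rw [gen_eq_inclU X (even_mem_gPlus hX), inclU_smul_vacuum, projU_ι, gPlusProj_of_even _ hX]

theorem upper_smul_vacuum (a : Fin n × Fin m) (y : M) :
    (upper a : U (gFull m n F)) • vacuum m n F M y = 0 := by
  have h : (Matrix.single (Sum.inl a.2) (Sum.inr a.1) 1 : Gl m n F) ∈ (gPlus m n F).carrier :=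
    fun i j => by simp
  rw [upper, gen_eq_inclU _ h, inclU_smul_vacuum, projU_ι,
    gPlusProj_of_odd _ (upperUnit_mem a.2 a.1 1), map_zero, zero_smul, map_zero]

theorem kac_induction {P : Kac m n F M → Prop} (h0 : P 0)
    (hadd : ∀ x y, P x → P y → P (x + y))
    (hmk : ∀ (u : U (gFull m n F)) (y : M), P (u • vacuum m n F M y)) (x : Kac m n F M) : P x := by
  obtain ⟨t, rfl⟩ := (kacRel m n F M).mkQ_surjective x
  induction t using TensorProduct.induction_on with
  | zero => rw [map_zero]; exact h0
  | add x y hx hy => rw [map_add]; exact hadd _ _ hx hy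
  | tmul u y => rw [← smul_vacuum]; exact hmk u y

variable [IsScalarTower F (U (gEven m n F)) M]

theorem kacToModel_vacuum (h2 : (2 : F) ≠ 0) (y : M) :
    kacToModel h2 (vacuum m n F M y) = 1 ⊗ₜ y := by
  change tensorToModel h2 (1 ⊗ₜ y) = _
  rw [tensorToModel_tmul, map_one, Module.End.one_apply]

theorem modelRep_lower (h2 : (2 : F) ≠ 0) (a : Fin n × Fin m) :
    modelRep m n F M h2 (lower a) = wedge m n F M (Matrix.single a.1 a.2 1) := by
  have h : modelRep m n F M h2 (lower a) =
    (kacOscillator m n F M).op (Matrix.single (Sum.inr a.1) (Sum.inl a.2) 1) := modelRep_ι h2 _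
  rw [h, lowerUnit_eq, Oscillator.op_fromBlocks, Prod.mk_zero_zero, map_zero, map_zero, zero_add,
    zero_add]
  rfl

/-- The projection of the Kac module onto `1 ⊗ M`. -/
def kacProj (h2 : (2 : F) ≠ 0) : Kac m n F M →ₗ[F] M :=
  modelProj m n F M ∘ₗ kacToModel h2

theorem kacProj_vacuum (h2 : (2 : F) ≠ 0) (y : M) : kacProj h2 (vacuum m n F M y) = y := by
  rw [kacProj, LinearMap.comp_apply, kacToModel_vacuum, modelProj_one_tmul]

theorem kacProj_lower_smul (h2 : (2 : F) ≠ 0) (a : Fin n × Fin m) (x : Kac m n F M) :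
    kacProj h2 ((lower a : U (gFull m n F)) • x) = 0 := by
  rw [kacProj, LinearMap.comp_apply, kacToModel_smul, modelRep_lower, modelProj_wedge]

theorem lower_prod_smul_vacuum_ne_zero (h2 : (2 : F) ≠ 0) {l : List (Fin n × Fin m)}
    (hl : l.Nodup) {y : M} (hy : y ≠ 0) :
    (l.map (lower (F := F))).prod • vacuum m n F M y ≠ 0 := by
  intro h
  apply wedge_prod_ne_zero (F := F) hl hy
  have h' := congrArg (kacToModel h2) h
  rw [map_zero, kacToModel_smul, kacToModel_vacuum, map_list_prod, List.map_map] at h'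
  rw [← h']
  congr 3
  funext a
  exact (modelRep_lower h2 a).symm

/-- At least one lowering factor stands on the left, and in the model it puts the vector in positive
exterior degree. -/
theorem kacProj_filtration_one (h2 : (2 : F) ≠ 0) {u : U (gFull m n F)}
    (hu : u ∈ lowerFiltration m n F 1) (y : M) : kacProj h2 (u • vacuum m n F M y) = 0 := by
  refine Submodule.span_induction
    (p := fun u _ => kacProj h2 (u • vacuum m n F M y) = 0) ?_ ?_ ?_ ?_ hu
  · rintro _ ⟨l, p, hl, rfl⟩
    cases l with
    | nil => simp at hl
    | cons a l => rw [List.map_cons, List.prod_cons, mul_assoc, mul_smul, kacProj_lower_smul]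
  · rw [zero_smul, map_zero]
  · intro u w _ _ hu hw
    rw [add_smul, map_add, hu, hw, add_zero]
  · intro c u _ hu
    rw [smul_assoc, map_smul, hu, smul_zero]

end Vacuum

end

end GLSuper

namespace GLSuper

noncomputable section

/-! ### Admissible orderings of the odd roots -/

section Order

variable {m n : ℕ}

/-- The covering-type relation on odd roots used to order the lowering operators. -/
def Before (b a : Fin n × Fin m) : Prop :=
  (b.1 = a.1 ∧ a.2 < b.2) ∨ (b.2 = a.2 ∧ b.1 < a.1)

/-- A list of odd roots each of which is preceded (to its right) by all smaller ones. -/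
inductive Admissible : List (Fin n × Fin m) → Prop
  | nil : Admissible []
  | cons (a : Fin n × Fin m) (l : List (Fin n × Fin m)) (hl : Admissible l) (ha : a ∉ l)
      (hb : ∀ b, Before b a → b ∈ l) : Admissible (a :: l)

theorem Admissible.mem_of_before {l : List (Fin n × Fin m)} (hl : Admissible l)
    {a b : Fin n × Fin m} (ha : a ∈ l) (hba : Before b a) : b ∈ l := by
  induction hl with
  | nil => simp at ha
  | cons c l _ _ hb ih =>
    rcases List.mem_cons.1 ha with rfl | ha
    · exact List.mem_cons_of_mem _ (hb _ hba)
    · exact List.mem_cons_of_mem _ (ih ha)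

theorem Admissible.nodup {l : List (Fin n × Fin m)} (hl : Admissible l) : l.Nodup := by
  induction hl with
  | nil => exact List.nodup_nil
  | cons c l _ ha _ ih => exact List.nodup_cons.2 ⟨ha, ih⟩

variable (m n) in
-- Greedy construction: keep adding in front an unused root of minimal height.
theorem exists_admissible : ∃ l : List (Fin n × Fin m), Admissible l ∧ ∀ a, a ∈ l := by
  have key : ∀ k ≤ Fintype.card (Fin n × Fin m),
      ∃ l : List (Fin n × Fin m), Admissible l ∧ l.length = k := by
    intro k
    induction k with
    | zero => exact fun _ => ⟨[], Admissible.nil, rfl⟩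
    | succ k ih =>
      intro hk
      obtain ⟨l, hl, hlen⟩ := ih (by omega)
      have hne : (Finset.univ \ l.toFinset).Nonempty := by
        rw [← Finset.card_pos, Finset.card_univ_sdiff, List.toFinset_card_of_nodup hl.nodup]
        omega
      -- The function a.1 + (m - a.2) strictly decreases from a to any b with `Before b a`, so all
      -- such b are already in the list.
      obtain ⟨a, ha, hmin⟩ := Finset.exists_min_image _
        (fun a : Fin n × Fin m => (a.1 : ℕ) + (m - (a.2 : ℕ))) hne
      refine ⟨a :: l, Admissible.cons a l hl (by simpa using ha) fun b hba => ?_, by simp [hlen]⟩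
      by_contra hbl
      have h := hmin b (by simpa using hbl)
      have ha2 := a.2.2
      have hb2 := b.2.2
      rcases hba with ⟨h1, h2⟩ | ⟨h1, h2⟩
      · rw [Fin.lt_def] at h2
        rw [h1] at h
        omega
      · rw [Fin.lt_def] at h2
        rw [h1] at h
        omega
  obtain ⟨l, hl, hlen⟩ := key _ le_rfl
  refine ⟨l, hl, fun a => ?_⟩
  have h : l.toFinset = Finset.univ := by
    rw [← Finset.card_eq_iff_eq_univ, List.toFinset_card_of_nodup hl.nodup, hlen]
  rw [← List.mem_toFinset, h]
  exact Finset.mem_univ a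

/-- Among the roots sharing the second index of a, exactly those preceding a are in l, by closure of
l under `Before`. This count and the next become the ρ-shift. -/
theorem Admissible.countP_snd {a : Fin n × Fin m} {l : List (Fin n × Fin m)}
    (h : Admissible (a :: l)) : l.countP (fun b => b.2 = a.2) = a.1 := by
  cases h with
  | cons _ _ hl ha hb =>
    rw [List.countP_eq_length_filter, ← List.toFinset_card_of_nodup (hl.nodup.filter _)]
    have : (l.filter fun b => b.2 = a.2).toFinset =
        (Finset.Iio a.1).image fun j => (j, a.2) := by
      ext ⟨j, i⟩
      simp only [List.mem_toFinset, List.mem_filter, decide_eq_true_eq, Finset.mem_image,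
        Finset.mem_Iio, Prod.mk.injEq]
      constructor
      · rintro ⟨h1, rfl⟩
        refine ⟨j, ?_, rfl, rfl⟩
        rcases lt_trichotomy j a.1 with h | rfl | h
        · exact h
        · exact absurd h1 ha
        · exact absurd (hl.mem_of_before (b := a) h1 (Or.inr ⟨rfl, h⟩)) ha
      · rintro ⟨_, h1, rfl, rfl⟩
        exact ⟨hb _ (Or.inr ⟨rfl, h1⟩), rfl⟩
    rw [this, Finset.card_image_of_injective _ (fun _ _ h => (Prod.ext_iff.1 h).1), Fin.card_Iio]

theorem Admissible.countP_fst {a : Fin n × Fin m} {l : List (Fin n × Fin m)}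
    (h : Admissible (a :: l)) : l.countP (fun b => b.1 = a.1) = m - 1 - a.2 := by
  cases h with
  | cons _ _ hl ha hb =>
    rw [List.countP_eq_length_filter, ← List.toFinset_card_of_nodup (hl.nodup.filter _)]
    have : (l.filter fun b => b.1 = a.1).toFinset =
        (Finset.Ioi a.2).image fun i => (a.1, i) := by
      ext ⟨j, i⟩
      simp only [List.mem_toFinset, List.mem_filter, decide_eq_true_eq, Finset.mem_image,
        Finset.mem_Ioi, Prod.mk.injEq]
      constructor
      · rintro ⟨h1, rfl⟩
        refine ⟨i, ?_, rfl, rfl⟩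
        rcases lt_trichotomy a.2 i with h | rfl | h
        · exact h
        · exact absurd h1 ha
        · exact absurd (hl.mem_of_before (b := a) h1 (Or.inl ⟨rfl, h⟩)) ha
      · rintro ⟨_, h1, rfl, rfl⟩
        exact ⟨hb _ (Or.inl ⟨rfl, h1⟩), rfl⟩
    rw [this, Finset.card_image_of_injective _ (fun _ _ h => (Prod.ext_iff.1 h).2), Fin.card_Ioi]

end Order

/-! ### Coordinates of ρ(m,n) -/

section Weights

variable {m n : ℕ} {F : Type*} [Field F]

theorem sum_I0 {A : Type*} [AddCommMonoid A] (f : Idx m n × Idx m n → A) :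
    ∑ q ∈ I0 m n, f q =
      (∑ a : Fin m, ∑ b : Fin m, if a < b then f (Sum.inl a, Sum.inl b) else 0) +
        ∑ a : Fin n, ∑ b : Fin n, if a < b then f (Sum.inr a, Sum.inr b) else 0 := by
  rw [I0, Finset.sum_filter, Fintype.sum_prod_type]
  simp [Fintype.sum_sum_type, InI0]
  congr 1 <;> exact Finset.sum_congr rfl fun a _ => Finset.sum_congr rfl fun b _ =>
    by by_cases h : a < b <;> simp [h]

theorem sum_I1 {A : Type*} [AddCommMonoid A] (f : Idx m n × Idx m n → A) :
    ∑ q ∈ I1 m n, f q = ∑ a : Fin m, ∑ b : Fin n, f (Sum.inl a, Sum.inr b) := by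
  rw [I1, Finset.sum_filter, Fintype.sum_prod_type]
  simp [Fintype.sum_sum_type, InI1]

theorem prod_I1 {A : Type*} [CommMonoid A] (f : Idx m n × Idx m n → A) :
    ∏ q ∈ I1 m n, f q = ∏ a : Fin n × Fin m, f (Sum.inl a.2, Sum.inr a.1) := by
  rw [I1, Finset.prod_filter, Fintype.prod_prod_type, Fintype.prod_prod_type, Finset.prod_comm]
  simp [Fintype.prod_sum_type, InI1]

theorem sum_roots_apply (k : ℕ) (i : Fin k) :
    (∑ a : Fin k, ∑ b : Fin k, if a < b then
      ((Pi.single a 1 : Fin k → F) i - (Pi.single b 1 : Fin k → F) i) else 0) =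
        ((k - 1 - (i : ℕ) : ℕ) : F) - (i : ℕ) := by
  have h : ∀ a b : Fin k, (if a < b then
      ((Pi.single a 1 : Fin k → F) i - (Pi.single b 1 : Fin k → F) i) else 0) =
      (if i = a then (if i < b then 1 else 0) else 0) -
        (if i = b then (if a < i then 1 else 0) else 0) := by
    intro a b
    by_cases h1 : i = a
    · subst h1
      by_cases h2 : i = b
      · subst h2; simp
      · by_cases h3 : i < b <;> simp [h2, h3]
    · by_cases h2 : i = b
      · subst h2
        by_cases h3 : a < i <;> simp [h1, h3]
      · simp [h1, h2]
  simp only [h, Finset.sum_sub_distrib]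
  rw [Finset.sum_comm]
  simp only [Finset.sum_ite_eq, Finset.mem_univ, if_true]
  rw [Finset.sum_boole, Finset.sum_boole, Finset.filter_lt_eq_Ioi, Finset.filter_gt_eq_Iio,
    Fin.card_Ioi, Fin.card_Iio]

theorem form_sub_ε (μ : Weight m n F) (i : Fin m) (j : Fin n) :
    form μ (ε (Sum.inl i) - ε (Sum.inr j)) = μ (Sum.inl i) + μ (Sum.inr j) := by
  simp [form, ε, Pi.single_apply]

theorem ρ_inl (h2 : (2 : F) ≠ 0) (i : Fin m) :
    2 * ρ m n F (Sum.inl i) = ((m - 1 - (i : ℕ) : ℕ) : F) - (i : ℕ) - n := by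
  simp only [ρ, ρ0, ρ1, Pi.sub_apply, Pi.smul_apply, Finset.sum_apply, smul_eq_mul, mul_sub]
  rw [← mul_assoc, ← mul_assoc, mul_inv_cancel₀ h2, one_mul, one_mul, sum_I0, sum_I1]
  have e := sum_roots_apply (F := F) m i
  simp only [Pi.single_apply] at e
  simp only [ε, Pi.single_apply, Sum.inl.injEq, reduceCtorEq, if_false, sub_self, ite_self,
    Finset.sum_const_zero, add_zero, sub_zero]
  rw [e]
  simp

theorem ρ_inr (h2 : (2 : F) ≠ 0) (j : Fin n) :
    2 * ρ m n F (Sum.inr j) = ((n - 1 - (j : ℕ) : ℕ) : F) - (j : ℕ) + m := by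
  simp only [ρ, ρ0, ρ1, Pi.sub_apply, Pi.smul_apply, Finset.sum_apply, smul_eq_mul, mul_sub]
  rw [← mul_assoc, ← mul_assoc, mul_inv_cancel₀ h2, one_mul, one_mul, sum_I0, sum_I1]
  have e := sum_roots_apply (F := F) n j
  simp only [Pi.single_apply] at e
  simp only [ε, Pi.single_apply, Sum.inr.injEq, reduceCtorEq, if_false, sub_self, ite_self,
    Finset.sum_const_zero, zero_add, zero_sub]
  rw [e]
  simp

/-- The right side is arranged as the eigenvalue of e_{ii} plus that of e_{jj} on the product of the
roots to the right of (j, i) in an admissible list: j of them involve i, and m - 1 - i of them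
involve j. -/
theorem form_add_ρ (h2 : (2 : F) ≠ 0) (lam : Weight m n F) (i : Fin m) (j : Fin n) :
    form (lam + ρ m n F) (ε (Sum.inl i) - ε (Sum.inr j)) =
      lam (Sum.inl i) - (j : ℕ) + (lam (Sum.inr j) + (m - 1 - (i : ℕ) : ℕ)) := by
  have hi : ((m - 1 - (i : ℕ) : ℕ) : F) = m - 1 - (i : ℕ) := by
    rw [Nat.sub_sub, Nat.cast_sub (by omega)]; push_cast; ring
  have hj : ((n - 1 - (j : ℕ) : ℕ) : F) = n - 1 - (j : ℕ) := by
    rw [Nat.sub_sub, Nat.cast_sub (by omega)]; push_cast; ring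
  have e1 := ρ_inl (n := n) h2 i
  have e2 := ρ_inr (m := m) h2 j
  rw [hi] at e1 ⊢
  rw [hj] at e2
  rw [form_sub_ε, Pi.add_apply, Pi.add_apply]
  apply mul_left_cancel₀ h2
  linear_combination e1 + e2

end Weights

/-! ### Evaluation of T₊T₋ on the maximal vector -/

section Maximal

variable {m n : ℕ} {F : Type*} [Field F]
variable {M : Type*} [AddCommGroup M] [Module F M] [Module (U (gEven m n F)) M]
variable {lam : Weight m n F} {v : M}

theorem diag_smul_vacuum (hv : IsMaximalVector lam v) (i : Idx m n) :
    (gen (Matrix.single i i 1) : U (gFull m n F)) • vacuum m n F M v =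
      lam i • vacuum m n F M v := by
  have h : Matrix.single i i (1 : F) ∈ homog m n F 0 := single_mem_gEven rfl 1
  rw [gen_even_smul_vacuum h, ← map_smul, ← hv.weight i]
  rfl

theorem raising_smul_vacuum (hv : IsMaximalVector lam v) {i j : Idx m n} (hij : InI0 (i, j)) :
    (gen (Matrix.single i j 1) : U (gFull m n F)) • vacuum m n F M v = 0 := by
  have h : Matrix.single i j (1 : F) ∈ homog m n F 0 := single_mem_gEven hij.par_eq 1
  rw [gen_even_smul_vacuum h, ← map_zero (vacuum m n F M), ← hv.raising i j hij]
  rfl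

/-- The bracket of the raising operator with a factor is, up to sign, a lowering unit whose root
comes `Before` that factor. Admissibility puts it further right in the product, so it occurs twice
and the term vanishes. -/
theorem left_raising_lower_prod (h2 : (2 : F) ≠ 0) (hv : IsMaximalVector lam v) {i i' : Fin m}
    (hi : i < i') {l : List (Fin n × Fin m)} (hl : Admissible l) :
    (gen (Matrix.single (Sum.inl i) (Sum.inl i') 1) : U (gFull m n F)) •
      (l.map (lower (F := F))).prod • vacuum m n F M v = 0 := by
  induction hl with
  | nil =>
    rw [List.map_nil, List.prod_nil, one_smul]
    exact raising_smul_vacuum hv (i := Sum.inl i) (j := Sum.inl i') hi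
  | cons a l hl ha hb ih =>
    obtain ⟨j, k⟩ := a
    rw [List.map_cons, List.prod_cons, ← mul_smul, ← mul_assoc, left_mul_lower, sub_mul, sub_smul,
      mul_assoc, mul_smul, mul_smul _ _ (vacuum m n F M v), ih, smul_zero, zero_sub, neg_eq_zero]
    split_ifs with h
    · rw [(anticommuting_lower h2).mul_prod_eq_zero (hb (j, i') (Or.inl ⟨rfl, show k < i' from h ▸ hi⟩)), zero_smul]
    · rw [zero_mul, zero_smul]

theorem right_raising_lower_prod (h2 : (2 : F) ≠ 0) (hv : IsMaximalVector lam v) {j j' : Fin n}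
    (hj : j < j') {l : List (Fin n × Fin m)} (hl : Admissible l) :
    (gen (Matrix.single (Sum.inr j) (Sum.inr j') 1) : U (gFull m n F)) •
      (l.map (lower (F := F))).prod • vacuum m n F M v = 0 := by
  induction hl with
  | nil =>
    rw [List.map_nil, List.prod_nil, one_smul]
    exact raising_smul_vacuum hv (i := Sum.inr j) (j := Sum.inr j') hj
  | cons a l hl ha hb ih =>
    obtain ⟨k, i⟩ := a
    rw [List.map_cons, List.prod_cons, ← mul_smul, ← mul_assoc, right_mul_lower, add_mul, add_smul,
      mul_assoc, mul_smul, mul_smul _ _ (vacuum m n F M v), ih, smul_zero, zero_add]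
    split_ifs with h
    · rw [(anticommuting_lower h2).mul_prod_eq_zero (hb (j, i) (Or.inr ⟨rfl, show j < k from h ▸ hj⟩)), zero_smul]
    · rw [zero_mul, zero_smul]

theorem left_diag_lower_prod (hv : IsMaximalVector lam v) (i : Fin m)
    (l : List (Fin n × Fin m)) :
    (gen (Matrix.single (Sum.inl i) (Sum.inl i) 1) : U (gFull m n F)) •
      (l.map (lower (F := F))).prod • vacuum m n F M v =
        (lam (Sum.inl i) - (l.countP fun b => b.2 = i : ℕ)) •
          (l.map (lower (F := F))).prod • vacuum m n F M v := by
  induction l with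
  | nil =>
    rw [List.map_nil, List.prod_nil, one_smul, diag_smul_vacuum hv]
    simp
  | cons a l ih =>
    obtain ⟨j, k⟩ := a
    rw [List.map_cons, List.prod_cons, ← mul_smul, ← mul_assoc, left_mul_lower, sub_mul, sub_smul,
      mul_assoc, mul_smul, mul_smul _ _ (vacuum m n F M v), ih, smul_comm, List.countP_cons,
      mul_smul]
    by_cases h : k = i
    · subst h
      simp [mul_smul, sub_smul, add_smul, sub_sub]
    · simp [h, mul_smul]

theorem right_diag_lower_prod (hv : IsMaximalVector lam v) (j : Fin n)
    (l : List (Fin n × Fin m)) :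
    (gen (Matrix.single (Sum.inr j) (Sum.inr j) 1) : U (gFull m n F)) •
      (l.map (lower (F := F))).prod • vacuum m n F M v =
        (lam (Sum.inr j) + (l.countP fun b => b.1 = j : ℕ)) •
          (l.map (lower (F := F))).prod • vacuum m n F M v := by
  induction l with
  | nil =>
    rw [List.map_nil, List.prod_nil, one_smul, diag_smul_vacuum hv]
    simp
  | cons a l ih =>
    obtain ⟨k, i⟩ := a
    rw [List.map_cons, List.prod_cons, ← mul_smul, ← mul_assoc, right_mul_lower, add_mul, add_smul,
      mul_assoc, mul_smul, mul_smul _ _ (vacuum m n F M v), ih, smul_comm, List.countP_cons,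
      mul_smul]
    by_cases h : j = k
    · subst h
      simp [mul_smul, add_smul, add_assoc]
    · simp [h, Ne.symm h, mul_smul]

/-- For a ≠ b with a not `Before` b, the anticommutator of `upper a` and `lower b` is zero or an
even raising operator, and raising operators kill admissible products. A root `Before` b would
already lie in the list. -/
theorem upper_lower_prod_eq_zero (h2 : (2 : F) ≠ 0) (hv : IsMaximalVector lam v)
    {l : List (Fin n × Fin m)} (hl : Admissible l) {a : Fin n × Fin m} (ha : a ∉ l) :
    (upper a : U (gFull m n F)) • (l.map (lower (F := F))).prod • vacuum m n F M v = 0 := by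
  induction hl with
  | nil => rw [List.map_nil, List.prod_nil, one_smul, upper_smul_vacuum]
  | cons b l hl hbl hb ih =>
    rw [List.mem_cons, not_or] at ha
    have hnb : ¬ Before a b := fun h => ha.2 (hb a h)
    obtain ⟨j', i'⟩ := b
    obtain ⟨j, i⟩ := a
    rw [List.map_cons, List.prod_cons, ← mul_smul, ← mul_assoc, upper_mul_lower, add_mul, add_smul,
      neg_mul, neg_smul, mul_assoc, mul_smul, mul_smul _ _ (vacuum m n F M v), ih ha.2, smul_zero,
      neg_zero, zero_add, add_mul, add_smul]
    have h1 : ((if j = j' then gen (Matrix.single (Sum.inl i) (Sum.inl i') 1) else 0 :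
        U (gFull m n F)) * (l.map lower).prod) • vacuum m n F M v = 0 := by
      split_ifs with h
      · rw [mul_smul]
        refine left_raising_lower_prod h2 hv ?_ hl
        rcases lt_trichotomy i i' with h' | h' | h'
        · exact h'
        · exact absurd (Prod.ext h h') ha.1
        · exact absurd (Or.inl ⟨h, h'⟩) hnb
      · rw [zero_mul, zero_smul]
    have h3 : ((if i' = i then gen (Matrix.single (Sum.inr j') (Sum.inr j) 1) else 0 :
        U (gFull m n F)) * (l.map lower).prod) • vacuum m n F M v = 0 := by
      split_ifs with h
      · rw [mul_smul]
        refine right_raising_lower_prod h2 hv ?_ hl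
        rcases lt_trichotomy j' j with h' | h' | h'
        · exact h'
        · exact absurd (Prod.ext h'.symm h.symm) ha.1
        · exact absurd (Or.inr ⟨h.symm, h'⟩) hnb
      · rw [zero_mul, zero_smul]
    rw [h1, h3, add_zero]

/-- The anticommutator of e_{ij} and e_{ji} is e_{ii} + e_{jj}, which acts on the remaining product
by its weight; the other term vanishes by `upper_lower_prod_eq_zero`. -/
theorem upper_lower_lower_prod (h2 : (2 : F) ≠ 0) (hv : IsMaximalVector lam v)
    {l : List (Fin n × Fin m)} {a : Fin n × Fin m} (hl : Admissible (a :: l)) :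
    (upper a : U (gFull m n F)) • ((a :: l).map (lower (F := F))).prod • vacuum m n F M v =
      form (lam + ρ m n F) (ε (Sum.inl a.2) - ε (Sum.inr a.1)) •
        (l.map (lower (F := F))).prod • vacuum m n F M v := by
  rw [form_add_ρ h2, ← hl.countP_fst, ← hl.countP_snd]
  cases hl with
  | cons _ _ hl ha hb =>
    have h0 := upper_lower_prod_eq_zero h2 hv hl ha
    obtain ⟨j, i⟩ := a
    rw [List.map_cons, List.prod_cons, ← mul_smul, ← mul_assoc, upper_mul_lower, add_mul, add_smul,
      neg_mul, neg_smul, mul_assoc, mul_smul, mul_smul _ _ (vacuum m n F M v), h0, smul_zero,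
      neg_zero, zero_add, if_pos rfl, if_pos rfl, add_mul, add_smul, mul_smul, mul_smul,
      left_diag_lower_prod hv, right_diag_lower_prod hv, ← add_smul]

/-- Reversing the list puts the partner of the leftmost lowering factor next to it, so the pairs
cancel from the inside outwards with no sign. -/
theorem upper_prod_lower_prod (h2 : (2 : F) ≠ 0) (hv : IsMaximalVector lam v)
    {l : List (Fin n × Fin m)} (hl : Admissible l) :
    (l.reverse.map (upper (F := F))).prod • (l.map (lower (F := F))).prod • vacuum m n F M v =
      (l.map fun a => form (lam + ρ m n F) (ε (Sum.inl a.2) - ε (Sum.inr a.1))).prod •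
        vacuum m n F M v := by
  induction l with
  | nil => simp
  | cons a l ih =>
    have hl' : Admissible l := by cases hl; assumption
    rw [List.reverse_cons, List.map_append, List.prod_append, mul_smul, List.map_singleton,
      List.prod_singleton, upper_lower_lower_prod h2 hv hl, smul_comm, ih hl', ← mul_smul,
      List.map_cons, List.prod_cons]

theorem prod_form_eq (l : List (Fin n × Fin m)) (hl : l.Nodup) (hfull : ∀ a, a ∈ l)
    (μ : Weight m n F) :
    (l.map fun a => form μ (ε (Sum.inl a.2) - ε (Sum.inr a.1))).prod =
      ∏ q ∈ I1 m n, form μ (ε q.1 - ε q.2) := by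
  rw [prod_I1, ← List.prod_toFinset _ hl]
  congr 1
  ext a
  simp [hfull a]

end Maximal

end

end GLSuper

namespace GLSuper

noncomputable section

/-! ### The ℤ/2-grading -/

section Grading

variable {m n : ℕ} {F : Type*} [Field F]

theorem proj_mem_homog (a : ZMod 2) (X : Gl m n F) : proj a X ∈ homog m n F a := by
  intro i j h
  simp [proj, h]

theorem proj_zero_add_proj_one (X : Gl m n F) : proj 0 X + proj 1 X = X := by
  ext i j
  have h01 : ∀ c : ZMod 2, c = 0 ∨ c = 1 := by decide
  rcases h01 (par i + par j) with h | h <;> simp [proj, h]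

theorem IsMonomial.mul {S : SubSuper m n F} {a b : ZMod 2} {u w : U S} (hu : IsMonomial S a u)
    (hw : IsMonomial S b w) : IsMonomial S (a + b) (u * w) := by
  induction hu with
  | one => rwa [zero_add, one_mul]
  | ι_mul a b' x hx u hu ih =>
    rw [add_assoc, mul_assoc]
    exact IsMonomial.ι_mul a _ x hx _ ih

theorem mul_mem_uHomog {S : SubSuper m n F} {a b c : ZMod 2} (hab : a + b = c) {u w : U S}
    (hu : u ∈ uHomog S a) (hw : w ∈ uHomog S b) : u * w ∈ uHomog S c := by
  subst hab
  have h := Submodule.mul_mem_mul hu hw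
  rw [uHomog, uHomog, Submodule.span_mul_span] at h
  refine Submodule.span_mono ?_ h
  rintro _ ⟨u, hu, w, hw, rfl⟩
  exact IsMonomial.mul hu hw

theorem ι_mem_uHomog {S : SubSuper m n F} {a : ZMod 2} (x : S.carrier)
    (hx : (x : Gl m n F) ∈ homog m n F a) : U.ι S x ∈ uHomog S a := by
  have h := IsMonomial.ι_mul a 0 x hx 1 IsMonomial.one
  rw [add_zero, mul_one] at h
  exact Submodule.subset_span h

/-- Only the existence of the decomposition is needed for graded submodules, not its uniqueness. -/
theorem exists_uHomog_add (S : SubSuper m n F) (u : U S) :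
    ∃ u₀ ∈ uHomog S 0, ∃ u₁ ∈ uHomog S 1, u = u₀ + u₁ := by
  induction u using U.induction with
  | hF r =>
    refine ⟨algebraMap F _ r, ?_, 0, Submodule.zero_mem _, (add_zero _).symm⟩
    rw [Algebra.algebraMap_eq_smul_one]
    exact Submodule.smul_mem _ _ (Submodule.subset_span IsMonomial.one)
  | hι x =>
    refine ⟨U.ι S ⟨proj 0 x, S.proj_mem 0 x x.2⟩, ι_mem_uHomog _ (proj_mem_homog _ _),
      U.ι S ⟨proj 1 x, S.proj_mem 1 x x.2⟩, ι_mem_uHomog _ (proj_mem_homog _ _), ?_⟩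
    rw [← map_add]
    congr 1
    exact Subtype.ext (proj_zero_add_proj_one (x : Gl m n F)).symm
  | hmul u w hu hw =>
    obtain ⟨u₀, hu₀, u₁, hu₁, rfl⟩ := hu
    obtain ⟨w₀, hw₀, w₁, hw₁, rfl⟩ := hw
    have h00 : u₀ * w₀ ∈ uHomog S 0 := mul_mem_uHomog (add_zero 0) hu₀ hw₀
    have h11 : u₁ * w₁ ∈ uHomog S 0 := mul_mem_uHomog (by decide) hu₁ hw₁
    have h01 : u₀ * w₁ ∈ uHomog S 1 := mul_mem_uHomog (zero_add 1) hu₀ hw₁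
    have h10 : u₁ * w₀ ∈ uHomog S 1 := mul_mem_uHomog (add_zero 1) hu₁ hw₀
    refine ⟨u₀ * w₀ + u₁ * w₁, (uHomog S 0).add_mem h00 h11,
      u₀ * w₁ + u₁ * w₀, (uHomog S 1).add_mem h01 h10, ?_⟩
    rw [add_mul, mul_add, mul_add]
    abel
  | hadd u w hu hw =>
    obtain ⟨u₀, hu₀, u₁, hu₁, rfl⟩ := hu
    obtain ⟨w₀, hw₀, w₁, hw₁, rfl⟩ := hw
    exact ⟨u₀ + w₀, Submodule.add_mem _ hu₀ hw₀, u₁ + w₁, Submodule.add_mem _ hu₁ hw₁,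
      add_add_add_comm _ _ _ _⟩

theorem exists_lower_prod_mem_uHomog (l : List (Fin n × Fin m)) :
    ∃ k, (l.map (lower (F := F))).prod ∈ uHomog (gFull m n F) k := by
  induction l with
  | nil => exact ⟨0, Submodule.subset_span IsMonomial.one⟩
  | cons a l ih =>
    obtain ⟨k, hk⟩ := ih
    exact ⟨1 + k, mul_mem_uHomog rfl (ι_mem_uHomog _ (lowerUnit_mem a.1 a.2 1)) hk⟩

variable {M : Type*} [AddCommGroup M] [Module F M] [Module (U (gEven m n F)) M]

theorem smul_vacuum_mem_kacHomog {a : ZMod 2} {u : U (gFull m n F)}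
    (hu : u ∈ uHomog (gFull m n F) a) (y : M) : u • vacuum m n F M y ∈ kacHomog m n F M a :=
  AddSubgroup.subset_closure ⟨u, hu, y, smul_vacuum u y⟩

/-- A submodule generated by vectors `w ⊗ y`, with `w` homogeneous, is graded. -/
theorem isGradedSub_span {w : U (gFull m n F)} {k : ZMod 2} (hw : w ∈ uHomog (gFull m n F) k) :
    IsGradedSub m n F M (Submodule.span (U (gFull m n F))
      (Set.range fun y : M => w • vacuum m n F M y)) := by
  intro t ht
  -- The claim is strengthened to all multiples u • t so that the scalar case of the span induction
  -- closes.
  have key : ∀ u : U (gFull m n F), ∃ t₀ ∈ Submodule.span (U (gFull m n F))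
      (Set.range fun y : M => w • vacuum m n F M y), ∃ t₁ ∈ Submodule.span (U (gFull m n F))
      (Set.range fun y : M => w • vacuum m n F M y),
      t₀ ∈ kacHomog m n F M 0 ∧ t₁ ∈ kacHomog m n F M 1 ∧ u • t = t₀ + t₁ := by
    induction ht using Submodule.span_induction with
    | mem t ht =>
      obtain ⟨y, rfl⟩ := ht
      intro u
      obtain ⟨u₀, hu₀, u₁, hu₁, rfl⟩ := exists_uHomog_add _ u
      have hmem : ∀ u : U (gFull m n F), u • w • vacuum m n F M y ∈
          Submodule.span (U (gFull m n F)) (Set.range fun y : M => w • vacuum m n F M y) :=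
        fun u => Submodule.smul_mem _ _ (Submodule.subset_span ⟨y, rfl⟩)
      have hhom : ∀ {a b : ZMod 2} {u : U (gFull m n F)}, u ∈ uHomog (gFull m n F) a →
          a + k = b → u • w • vacuum m n F M y ∈ kacHomog m n F M b := by
        rintro a b u hu rfl
        rw [← mul_smul]
        exact smul_vacuum_mem_kacHomog (mul_mem_uHomog rfl hu hw) y
      have h01 : ∀ c : ZMod 2, c = 0 ∨ c = 1 := by decide
      rcases h01 k with rfl | rfl
      · exact ⟨_, hmem u₀, _, hmem u₁, hhom hu₀ rfl, hhom hu₁ rfl, add_smul _ _ _⟩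
      · exact ⟨_, hmem u₁, _, hmem u₀, hhom hu₁ rfl, hhom hu₀ rfl,
          (add_smul _ _ _).trans (add_comm _ _)⟩
    | zero =>
      exact fun u => ⟨0, Submodule.zero_mem _, 0, Submodule.zero_mem _, AddSubgroup.zero_mem _,
        AddSubgroup.zero_mem _, by rw [smul_zero, add_zero]⟩
    | add x y _ _ hx hy =>
      intro u
      obtain ⟨x₀, hx₀, x₁, hx₁, gx₀, gx₁, ex⟩ := hx u
      obtain ⟨y₀, hy₀, y₁, hy₁, gy₀, gy₁, ey⟩ := hy u
      exact ⟨x₀ + y₀, Submodule.add_mem _ hx₀ hy₀, x₁ + y₁, Submodule.add_mem _ hx₁ hy₁,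
        AddSubgroup.add_mem _ gx₀ gy₀, AddSubgroup.add_mem _ gx₁ gy₁,
        by rw [smul_add, ex, ey, add_add_add_comm]⟩
    | smul r x _ hx =>
      intro u
      rw [← mul_smul]
      exact hx (u * r)
  simpa using key 1

end Grading

/-! ### Simplicity when the product is nonzero -/

section Simplicity

variable {m n : ℕ} {F : Type*} [Field F]
variable {M : Type*} [AddCommGroup M] [Module F M] [Module (U (gEven m n F)) M]

/-- By `lowerFiltration_zero`, U(𝔤⁺) is absorbed into M; repeated factors vanish, and reordering
signs are absorbed into the coefficients. Uniqueness of the coefficients is not needed. -/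
theorem exists_eq_sum_lower_prod (h2 : (2 : F) ≠ 0) (x : Kac m n F M) :
    ∃ μ : Finset (Fin n × Fin m) → M,
      x = ∑ S, (S.toList.map (lower (F := F))).prod • vacuum m n F M (μ S) := by
  have hadd : ∀ x y : Kac m n F M,
      (∃ μ : Finset (Fin n × Fin m) → M,
        x = ∑ S, (S.toList.map (lower (F := F))).prod • vacuum m n F M (μ S)) →
      (∃ μ : Finset (Fin n × Fin m) → M,
        y = ∑ S, (S.toList.map (lower (F := F))).prod • vacuum m n F M (μ S)) →
      ∃ μ : Finset (Fin n × Fin m) → M,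
        x + y = ∑ S, (S.toList.map (lower (F := F))).prod • vacuum m n F M (μ S) := by
    rintro _ _ ⟨μ, rfl⟩ ⟨ν, rfl⟩
    refine ⟨μ + ν, ?_⟩
    simp only [Pi.add_apply, map_add, smul_add, Finset.sum_add_distrib]
  have hsingle : ∀ (S : Finset (Fin n × Fin m)) (y : M),
      ∃ μ : Finset (Fin n × Fin m) → M,
        (S.toList.map (lower (F := F))).prod • vacuum m n F M y =
          ∑ S, (S.toList.map (lower (F := F))).prod • vacuum m n F M (μ S) := by
    intro S y
    refine ⟨Pi.single S y, ?_⟩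
    rw [Finset.sum_eq_single S, Pi.single_eq_same]
    · intro S' _ hS
      rw [Pi.single_eq_of_ne hS, map_zero, smul_zero]
    · simp
  have hzero : ∃ μ : Finset (Fin n × Fin m) → M,
      (0 : Kac m n F M) = ∑ S, (S.toList.map (lower (F := F))).prod • vacuum m n F M (μ S) :=
    ⟨0, by simp⟩
  induction x using kac_induction with
  | h0 => exact hzero
  | hadd x y hx hy => exact hadd x y hx hy
  | hmk u y =>
    have hu : u ∈ lowerFiltration m n F 0 := by rw [lowerFiltration_zero]; trivial
    refine Submodule.span_induction (p := fun u _ => ∃ μ : Finset (Fin n × Fin m) → M,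
      u • vacuum m n F M y = ∑ S, (S.toList.map (lower (F := F))).prod • vacuum m n F M (μ S))
      ?_ ?_ ?_ ?_ hu
    · rintro _ ⟨l, p, -, rfl⟩
      rw [mul_smul, inclU_smul_vacuum]
      by_cases hl : l.Nodup
      · have hperm : l.Perm l.toFinset.toList := by
          rw [List.perm_ext_iff_of_nodup hl (Finset.nodup_toList _)]
          simp
        rcases (anticommuting_lower h2).prod_perm hperm with h | h
        · rw [h]
          exact hsingle _ _
        · rw [h, neg_smul, ← smul_neg, ← map_neg]
          exact hsingle _ _
      · rw [(anticommuting_lower h2).prod_eq_zero hl, zero_smul]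
        exact hzero
    · rw [zero_smul]
      exact hzero
    · intro u w _ _ hu hw
      rw [add_smul]
      exact hadd _ _ hu hw
    · rintro c u _ ⟨μ, hμ⟩
      refine ⟨c • μ, ?_⟩
      rw [smul_assoc, hμ, Finset.smul_sum]
      refine Finset.sum_congr rfl fun S _ => ?_
      rw [Pi.smul_apply, map_smul, smul_comm]

/-- A nonzero submodule of the Kac module meets `Λ^{top}(𝔤_{-1}) ⊗ M`. -/
theorem exists_lower_prod_mem (h2 : (2 : F) ≠ 0) {L : List (Fin n × Fin m)}
    (hL : L.Nodup) (hfull : ∀ a, a ∈ L) {N : Submodule (U (gFull m n F)) (Kac m n F M)}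
    (hN : N ≠ ⊥) :
    ∃ y : M, y ≠ 0 ∧ (L.map (lower (F := F))).prod • vacuum m n F M y ∈ N := by
  classical
  obtain ⟨x, hxN, hx0⟩ := Submodule.exists_mem_ne_zero_of_ne_bot hN
  obtain ⟨μ, rfl⟩ := exists_eq_sum_lower_prod h2 x
  have hne : (Finset.univ.filter fun S => μ S ≠ 0).Nonempty := by
    by_contra h
    rw [Finset.not_nonempty_iff_eq_empty, Finset.filter_eq_empty_iff] at h
    apply hx0
    refine Finset.sum_eq_zero fun S hS => ?_
    rw [not_not.1 (h hS), map_zero, smul_zero]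
  -- For S of least size with nonzero coefficient, the product over the complement of S kills every
  -- other term: another such S' is not contained in S, hence meets the complement and repeats a
  -- factor.
  obtain ⟨S, hS, hmin⟩ := Finset.exists_min_image _ Finset.card hne
  rw [Finset.mem_filter] at hS
  have hmem := N.smul_mem ((Sᶜ.toList.map (lower (F := F))).prod) hxN
  rw [Finset.smul_sum, Finset.sum_eq_single S] at hmem
  · rw [← mul_smul, ← List.prod_append, ← List.map_append] at hmem
    have hperm : (Sᶜ.toList ++ S.toList).Perm L := by
      rw [List.perm_ext_iff_of_nodup _ hL]
      · intro a
        simp only [List.mem_append, Finset.mem_toList, Finset.mem_compl, hfull a, iff_true]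
        exact (em (a ∈ S)).symm
      · rw [List.nodup_append']
        refine ⟨Finset.nodup_toList _, Finset.nodup_toList _, fun a h1 h3 => ?_⟩
        rw [Finset.mem_toList] at h1 h3
        exact Finset.mem_compl.1 h1 h3
    refine ⟨μ S, hS.2, ?_⟩
    rcases (anticommuting_lower h2).prod_perm hperm with h | h
    · rwa [h] at hmem
    · rwa [h, neg_smul, neg_mem_iff] at hmem
  · intro S' _ hSS'
    by_cases h0 : μ S' = 0
    · rw [h0, map_zero, smul_zero, smul_zero]
    · have hcard := hmin S' (by simpa using h0)
      have hnot : ¬ S' ⊆ S := fun h => hSS' (Finset.eq_of_subset_of_card_le h hcard)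
      obtain ⟨a, ha', ha⟩ := Finset.not_subset.1 hnot
      rw [← mul_smul, ← List.prod_append, ← List.map_append,
        (anticommuting_lower h2).prod_eq_zero, zero_smul]
      intro h
      rw [List.nodup_append'] at h
      exact h.2.2 (Finset.mem_toList.2 (Finset.mem_compl.2 ha)) (Finset.mem_toList.2 ha')
  · simp

variable [IsScalarTower F (U (gEven m n F)) M]

/-- Since T is normalized by 𝔤_0 up to scalars, the y with T(1 ⊗ y) ∈ N form a U(𝔤_0)-submodule of
M. It is applied with T equal to 1, to T₋, and, with N = 0, to T₊T₋. -/
theorem smul_vacuum_smul_mem {T : U (gFull m n F)}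
    (hT : ∀ X ∈ homog m n F 0, ∃ k : F, gen X * T = T * gen X + k • T)
    {N : Submodule (U (gFull m n F)) (Kac m n F M)} (u : U (gEven m n F)) {y : M}
    (hy : T • vacuum m n F M y ∈ N) : T • vacuum m n F M (u • y) ∈ N := by
  induction u using U.induction generalizing y with
  | hF r =>
    rw [algebraMap_smul, map_smul, smul_comm]
    exact N.smul_of_tower_mem r hy
  | hι x =>
    obtain ⟨X, hX⟩ := x
    obtain ⟨k, hk⟩ := hT X hX
    rw [← gen_even_smul_vacuum hX, ← mul_smul, ← sub_eq_iff_eq_add.2 hk, sub_smul, mul_smul,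
      smul_assoc]
    exact N.sub_mem (N.smul_mem _ hy) (N.smul_of_tower_mem k hy)
  | hmul u w hu hw =>
    rw [mul_smul]
    exact hu (hw hy)
  | hadd u w hu hw =>
    rw [add_smul, map_add, smul_add]
    exact N.add_mem (hu hy) (hw hy)

theorem normalizes_lower_prod (h2 : (2 : F) ≠ 0) {L : List (Fin n × Fin m)}
    (hfull : ∀ a, a ∈ L) (X : Gl m n F) (hX : X ∈ homog m n F 0) :
    ∃ k : F, gen X * (L.map lower).prod = (L.map lower).prod * gen X + k • (L.map lower).prod :=
  (anticommuting_lower h2).exists_mul_prod_eq (gen_even_commutator_lower hX) hfull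

theorem normalizes_upper_prod (h2 : (2 : F) ≠ 0) {L : List (Fin n × Fin m)}
    (hfull : ∀ a, a ∈ L) (X : Gl m n F) (hX : X ∈ homog m n F 0) :
    ∃ k : F, gen X * (L.map upper).prod = (L.map upper).prod * gen X + k • (L.map upper).prod :=
  (anticommuting_upper h2).exists_mul_prod_eq (gen_even_commutator_upper hX) hfull

theorem eq_top_of_lower_prod_mem (h2 : (2 : F) ≠ 0) {L : List (Fin n × Fin m)}
    (hL : Admissible L) (hfull : ∀ a, a ∈ L) {lam : Weight m n F} {v : M}
    (hv : IsMaximalVector lam v) (hgen : Submodule.span (U (gEven m n F)) {v} = ⊤)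
    (hprod : ∏ q ∈ I1 m n, form (lam + ρ m n F) (ε q.1 - ε q.2) ≠ 0)
    {N : Submodule (U (gFull m n F)) (Kac m n F M)}
    (hN : (L.map (lower (F := F))).prod • vacuum m n F M v ∈ N) : N = ⊤ := by
  have h1 := N.smul_mem ((L.reverse.map (upper (F := F))).prod) hN
  rw [upper_prod_lower_prod h2 hv hL, prod_form_eq L hL.nodup hfull] at h1
  have hvN : vacuum m n F M v ∈ N := by
    have := N.smul_of_tower_mem (∏ q ∈ I1 m n, form (lam + ρ m n F) (ε q.1 - ε q.2))⁻¹ h1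
    rwa [smul_smul, inv_mul_cancel₀ hprod, one_smul] at this
  have hyN : ∀ y, vacuum m n F M y ∈ N := by
    intro y
    have hy : y ∈ Submodule.span (U (gEven m n F)) {v} := by rw [hgen]; trivial
    obtain ⟨u, rfl⟩ := Submodule.mem_span_singleton.1 hy
    have := smul_vacuum_smul_mem (T := 1) (fun X _ => ⟨0, by simp⟩) u
      (by rwa [one_smul] : (1 : U (gFull m n F)) • vacuum m n F M v ∈ N)
    rwa [one_smul] at this
  rw [eq_top_iff]
  intro x _
  induction x using kac_induction with
  | h0 => exact N.zero_mem
  | hadd x y hx hy => exact N.add_mem (hx trivial) (hy trivial)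
  | hmk u y => exact N.smul_mem u (hyN y)

theorem nontrivial_kac (h2 : (2 : F) ≠ 0) {v : M} (hv : v ≠ 0) : Nontrivial (Kac m n F M) := by
  refine ⟨⟨vacuum m n F M v, 0, fun h => hv ?_⟩⟩
  rw [← kacProj_vacuum (m := m) (n := n) h2 v, h, map_zero]

theorem isSimpleModule_kac [IsSimpleModule (U (gEven m n F)) M] (h2 : (2 : F) ≠ 0)
    {lam : Weight m n F} {v : M}
    (hv : IsMaximalVector lam v) (hgen : Submodule.span (U (gEven m n F)) {v} = ⊤)
    (hprod : ∏ q ∈ I1 m n, form (lam + ρ m n F) (ε q.1 - ε q.2) ≠ 0) :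
    IsSimpleModule (U (gFull m n F)) (Kac m n F M) := by
  obtain ⟨L, hL, hfull⟩ := exists_admissible m n
  have := nontrivial_kac (m := m) (n := n) h2 hv.ne_zero
  rw [isSimpleModule_iff]
  refine ⟨fun N => or_iff_not_imp_left.2 fun hN => ?_⟩
  obtain ⟨y, hy, hyN⟩ := exists_lower_prod_mem h2 hL.nodup hfull hN
  -- Simplicity of M moves the unknown y to the maximal vector v, where T₊T₋ is computed.
  obtain ⟨u, rfl⟩ := IsSimpleModule.toSpanSingleton_surjective (U (gEven m n F)) hy v
  exact eq_top_of_lower_prod_mem h2 hL hfull hv hgen hprod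
    (smul_vacuum_smul_mem (normalizes_lower_prod h2 hfull) u hyN)

/-! ### A proper graded submodule when the product vanishes -/

theorem upper_prod_mul_mem_filtration (l : List (Fin n × Fin m)) {k : ℕ} {u : U (gFull m n F)}
    (hu : u ∈ lowerFiltration m n F k) :
    (l.map upper).prod * u ∈ lowerFiltration m n F (k - l.length) := by
  induction l with
  | nil => simpa using hu
  | cons a l ih =>
    have h : (Matrix.single (Sum.inl a.2) (Sum.inr a.1) 1 : Gl m n F) ∈ (gPlus m n F).carrier :=
      fun i j => by simp
    rw [List.map_cons, List.prod_cons, mul_assoc, List.length_cons, ← Nat.sub_sub]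
    exact upper_mul_mem_filtration (upperUnit_mem a.2 a.1 1) h ih

/-- T₊T₋ is itself normalized by 𝔤_0, the two scalars adding up, so vanishing on 1 ⊗ v spreads to 1
⊗ M because v generates M. -/
theorem upper_prod_lower_prod_eq_zero (h2 : (2 : F) ≠ 0) {L : List (Fin n × Fin m)}
    (hL : Admissible L) (hfull : ∀ a, a ∈ L) {lam : Weight m n F} {v : M}
    (hv : IsMaximalVector lam v) (hgen : Submodule.span (U (gEven m n F)) {v} = ⊤)
    (hprod : ∏ q ∈ I1 m n, form (lam + ρ m n F) (ε q.1 - ε q.2) = 0) (y : M) :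
    ((L.reverse.map (upper (F := F))).prod * (L.map lower).prod) • vacuum m n F M y = 0 := by
  have hy : y ∈ Submodule.span (U (gEven m n F)) {v} := by rw [hgen]; trivial
  obtain ⟨u, rfl⟩ := Submodule.mem_span_singleton.1 hy
  rw [← Submodule.mem_bot (U (gFull m n F))]
  refine smul_vacuum_smul_mem (fun X hX => ?_) u ?_
  · obtain ⟨k, hk⟩ := normalizes_lower_prod h2 hfull X hX
    obtain ⟨k', hk'⟩ := normalizes_upper_prod h2 (L := L.reverse) (by simpa using hfull) X hX
    refine ⟨k' + k, ?_⟩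
    rw [← mul_assoc, hk', add_mul, mul_assoc, hk, mul_add, add_smul, smul_mul_assoc,
      mul_smul_comm, ← mul_assoc]
    abel
  · rw [Submodule.mem_bot, mul_smul, upper_prod_lower_prod h2 hv hL,
      prod_form_eq L hL.nodup hfull, hprod, zero_smul]

/-- Fewer raising factors than the length of T₋ leave some lowering factor, which the projection
kills; otherwise the raising product is zero or T₊ up to sign. -/
theorem kacProj_upper_prod_lower_prod (h2 : (2 : F) ≠ 0) {L : List (Fin n × Fin m)}
    (hL : Admissible L) (hfull : ∀ a, a ∈ L) {lam : Weight m n F} {v : M}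
    (hv : IsMaximalVector lam v) (hgen : Submodule.span (U (gEven m n F)) {v} = ⊤)
    (hprod : ∏ q ∈ I1 m n, form (lam + ρ m n F) (ε q.1 - ε q.2) = 0) (y : M)
    (l : List (Fin n × Fin m)) :
    kacProj h2 (((l.map (upper (F := F))).prod * (L.map lower).prod) • vacuum m n F M y) = 0 := by
  rcases lt_or_ge l.length L.length with hlt | hge
  · refine kacProj_filtration_one h2 (lowerFiltration_anti (Nat.sub_pos_of_lt hlt)
      (upper_prod_mul_mem_filtration l ?_)) y
    exact Submodule.subset_span ⟨L, 1, le_rfl, by rw [map_one, mul_one]⟩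
  · have h0 := upper_prod_lower_prod_eq_zero h2 hL hfull hv hgen hprod y
    rcases (anticommuting_upper h2).prod_of_length (L := L.reverse) (l := l)
      (by simpa using hfull) (by simpa using hge) with h | h | h <;> rw [h]
    · rw [h0, map_zero]
    · rw [neg_mul, neg_smul, h0, neg_zero, map_zero]
    · rw [zero_mul, zero_smul, map_zero]

variable (m n F) in
/-- The span `Λ(𝔤_1) w U(𝔤⁺)`. -/
def upperSpan (w : U (gFull m n F)) : Submodule F (U (gFull m n F)) :=
  Submodule.span F {u | ∃ (l : List (Fin n × Fin m)) (q : U (gPlus m n F)),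
    u = (l.map upper).prod * w * inclU m n F q}

theorem gen_even_mul_mem_upperSpan {w : U (gFull m n F)}
    (hw : ∀ X ∈ homog m n F 0, ∃ k : F, gen X * w = w * gen X + k • w) {X : Gl m n F}
    (hX : X ∈ homog m n F 0) {u : U (gFull m n F)} (hu : u ∈ upperSpan m n F w) :
    gen X * u ∈ upperSpan m n F w := by
  refine mul_mem_of_span rfl ?_ hu
  rintro _ ⟨l, q, rfl⟩
  obtain ⟨k, hk⟩ := hw X hX
  have h := commutator_prod_mem_span (F := F) (gen_even_commutator_upper hX) l
  have e : gen X * ((l.map upper).prod * w * inclU m n F q) =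
      (gen X * (l.map upper).prod - (l.map upper).prod * gen X) * (w * inclU m n F q) +
        ((l.map upper).prod * w * inclU m n F (U.ι _ ⟨X, even_mem_gPlus hX⟩ * q) +
          k • ((l.map upper).prod * w * inclU m n F q)) := by
    have e' : (l.map upper).prod * gen X * (w * inclU m n F q) =
        (l.map upper).prod * w * (gen X * inclU m n F q) +
          k • ((l.map upper).prod * w * inclU m n F q) := by
      rw [mul_assoc, ← mul_assoc (gen X), hk, add_mul, mul_add, smul_mul_assoc, mul_smul_comm]
      simp only [mul_assoc]
    rw [map_mul, ← gen_eq_inclU, ← e']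
    noncomm_ring
  rw [e]
  refine Submodule.add_mem _ (mul_mem_of_mem_span ?_ h) (Submodule.add_mem _
    (Submodule.subset_span ⟨l, _, rfl⟩)
    (Submodule.smul_mem _ _ (Submodule.subset_span ⟨l, _, rfl⟩)))
  rintro _ ⟨l', -, rfl⟩
  exact Submodule.subset_span ⟨l', q, (mul_assoc _ _ _).symm⟩

/-- Elements of 𝔤_1 join the raising factors on the left, while elements of 𝔤_0 pass through them
and through w into U(𝔤⁺) on the right, leaving terms of the same shape. -/
theorem inclU_mul_mem_upperSpan {w : U (gFull m n F)}
    (hw : ∀ X ∈ homog m n F 0, ∃ k : F, gen X * w = w * gen X + k • w)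
    (p : U (gPlus m n F)) {u : U (gFull m n F)} (hu : u ∈ upperSpan m n F w) :
    inclU m n F p * u ∈ upperSpan m n F w := by
  induction p using U.induction generalizing u with
  | hF r =>
    rw [AlgHom.commutes, ← Algebra.smul_def]
    exact Submodule.smul_mem _ _ hu
  | hι x =>
    obtain ⟨X, hX⟩ := x
    rw [← gen_eq_inclU]
    have e : X = Matrix.fromBlocks X.toBlocks₁₁ 0 0 X.toBlocks₂₂ +
        Matrix.fromBlocks 0 X.toBlocks₁₂ 0 0 := by
      have h21 : X.toBlocks₂₁ = 0 := by
        ext i j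
        exact hX i j
      conv_lhs => rw [← Matrix.fromBlocks_toBlocks X]
      simp [Matrix.fromBlocks_add, h21]
    rw [e, map_add, add_mul]
    refine Submodule.add_mem _ ?_ ?_
    · exact gen_even_mul_mem_upperSpan hw (evenIncl m n F (X.toBlocks₁₁, X.toBlocks₂₂)).2 hu
    · refine mul_mem_of_mem_span ?_ (gen_upper_mem_span _)
      rintro _ ⟨a, rfl⟩
      refine mul_mem_of_span rfl ?_ hu
      rintro _ ⟨l, q, rfl⟩
      exact Submodule.subset_span ⟨a :: l, q, by simp [mul_assoc]⟩
  | hmul p q hp hq =>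
    rw [map_mul, mul_assoc]
    exact hp (hq hu)
  | hadd p q hp hq =>
    rw [map_add, add_mul]
    exact Submodule.add_mem _ (hp hu) (hq hu)

/-- Decompose u by U(𝔤) = Λ(𝔤_{-1})U(𝔤⁺). A lowering factor on the left gives projection zero;
without one, `upperSpan` reduces u T₋ to raising products times T₋ acting on 1 ⊗ M. -/
theorem kacProj_smul_lower_prod (h2 : (2 : F) ≠ 0) {L : List (Fin n × Fin m)}
    (hL : Admissible L) (hfull : ∀ a, a ∈ L) {lam : Weight m n F} {v : M}
    (hv : IsMaximalVector lam v) (hgen : Submodule.span (U (gEven m n F)) {v} = ⊤)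
    (hprod : ∏ q ∈ I1 m n, form (lam + ρ m n F) (ε q.1 - ε q.2) = 0)
    (u : U (gFull m n F)) (y : M) :
    kacProj h2 (u • (L.map (lower (F := F))).prod • vacuum m n F M y) = 0 := by
  have hu : u ∈ lowerFiltration m n F 0 := by rw [lowerFiltration_zero]; trivial
  refine Submodule.span_induction (p := fun u _ =>
    kacProj h2 (u • (L.map (lower (F := F))).prod • vacuum m n F M y) = 0) ?_ ?_ ?_ ?_ hu
  · rintro _ ⟨l, p, -, rfl⟩
    cases l with
    | cons a l => rw [List.map_cons, List.prod_cons, mul_assoc, mul_smul, kacProj_lower_smul]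
    | nil =>
      rw [List.map_nil, List.prod_nil, one_mul, ← mul_smul]
      have hmem : inclU m n F p * (L.map lower).prod ∈
          upperSpan m n F (L.map (lower (F := F))).prod :=
        inclU_mul_mem_upperSpan (normalizes_lower_prod h2 hfull) p
          (Submodule.subset_span ⟨[], 1, by simp⟩)
      refine Submodule.span_induction (p := fun u _ => kacProj h2 (u • vacuum m n F M y) = 0)
        ?_ ?_ ?_ ?_ hmem
      · rintro _ ⟨l, q, rfl⟩
        rw [mul_smul, inclU_smul_vacuum]
        exact kacProj_upper_prod_lower_prod h2 hL hfull hv hgen hprod _ l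
      · rw [zero_smul, map_zero]
      · intro u w _ _ hu hw
        rw [add_smul, map_add, hu, hw, add_zero]
      · intro c u _ hu
        rw [smul_assoc, map_smul, hu, smul_zero]
  · rw [zero_smul, map_zero]
  · intro u w _ _ hu hw
    rw [add_smul, map_add, hu, hw, add_zero]
  · intro c u _ hu
    rw [smul_assoc, map_smul, hu, smul_zero]

theorem not_kacIsGradedSimple (h2 : (2 : F) ≠ 0) {lam : Weight m n F} {v : M}
    (hv : IsMaximalVector lam v) (hgen : Submodule.span (U (gEven m n F)) {v} = ⊤)
    (hprod : ∏ q ∈ I1 m n, form (lam + ρ m n F) (ε q.1 - ε q.2) = 0) :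
    ¬ KacIsGradedSimple m n F M := by
  rintro ⟨-, hsimple⟩
  obtain ⟨L, hL, hfull⟩ := exists_admissible m n
  obtain ⟨k, hk⟩ := exists_lower_prod_mem_uHomog (F := F) L
  -- The submodule generated by T₋ ⊗ M contains T₋ ⊗ v ≠ 0, yet `kacProj` vanishes on it while
  -- sending 1 ⊗ v to v ≠ 0.
  rcases hsimple _ (isGradedSub_span (M := M) hk) with h | h
  · refine lower_prod_smul_vacuum_ne_zero h2 hL.nodup hv.ne_zero ?_
    rw [← Submodule.mem_bot (U (gFull m n F)), ← h]
    exact Submodule.subset_span ⟨v, rfl⟩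
  · apply hv.ne_zero
    rw [← kacProj_vacuum (m := m) (n := n) h2 v]
    have hmem : vacuum m n F M v ∈ Submodule.span (U (gFull m n F))
        (Set.range fun y : M => (L.map (lower (F := F))).prod • vacuum m n F M y) := by
      rw [h]; trivial
    generalize vacuum m n F M v = x at hmem
    have key : ∀ u : U (gFull m n F), kacProj h2 (u • x) = 0 := by
      induction hmem using Submodule.span_induction with
      | mem x hx =>
        obtain ⟨y, rfl⟩ := hx
        exact fun u => kacProj_smul_lower_prod h2 hL hfull hv hgen hprod u y
      | zero => exact fun u => by rw [smul_zero, map_zero]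
      | add x y _ _ hx hy => exact fun u => by rw [smul_add, map_add, hx, hy, add_zero]
      | smul r x _ hx => exact fun u => by rw [← mul_smul]; exact hx _
    simpa using key 1

end Simplicity

end

end GLSuper

open GLSuper
theorem corollary4p3 (m n p : ℕ) (hp : 2 < p) (F : Type*) [Field F] [CharP F p]
    (M : Type*) [AddCommGroup M] [Module F M] [Module (U (gEven m n F)) M]
    [IsScalarTower F (U (gEven m n F)) M] [IsSimpleModule (U (gEven m n F)) M]
    (lam : Weight m n F) (v : M) (hv : IsMaximalVector lam v)
    (hgen : Submodule.span (U (gEven m n F)) {v} = ⊤) :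
    (KacIsGradedSimple m n F M ↔
      ∏ q ∈ I1 m n, form (lam + ρ m n F) (ε q.1 - ε q.2) ≠ 0) ∧
    (IsSimpleModule (U (gFull m n F)) (Kac m n F M) ↔
      ∏ q ∈ I1 m n, form (lam + ρ m n F) (ε q.1 - ε q.2) ≠ 0) := by
  -- The characteristic enters only through the invertibility of 2.
  have h2 : (2 : F) ≠ 0 := by
    intro h
    have h' : ((2 : ℕ) : F) = 0 := by exact_mod_cast h
    exact absurd (Nat.le_of_dvd two_pos ((CharP.cast_eq_zero_iff F p 2).1 h')) (not_le.2 hp)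
  have graded_of_simple : IsSimpleModule (U (gFull m n F)) (Kac m n F M) →
      KacIsGradedSimple m n F M := fun h =>
    ⟨IsSimpleModule.nontrivial (U (gFull m n F)) _, fun N _ => eq_bot_or_eq_top N⟩
  have ne_of_graded : KacIsGradedSimple m n F M →
      ∏ q ∈ I1 m n, form (lam + ρ m n F) (ε q.1 - ε q.2) ≠ 0 :=
    fun h h0 => not_kacIsGradedSimple h2 hv hgen h0 h
  -- The implications form a cycle: nonzero product, ungraded simplicity, graded simplicity, nonzero
  -- product.
  exact ⟨⟨ne_of_graded, fun h => graded_of_simple (isSimpleModule_kac h2 hv hgen h)⟩,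
    ⟨fun h => ne_of_graded (graded_of_simple h), isSimpleModule_kac h2 hv hgen⟩⟩
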